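/- Let $n\ge 4$ and let $\mathfrak m_0(n)=\mathrm{Span}(e_1,\dots,e_n)$ be the Lie algebra over $\mathbb F_2=\mathbb Z/2$ whose nonzero brackets of basis vectors are $[e_1,e_i]=[e_i,e_1]=e_{i+1}$ for $2\le i\le n-1$. Let $e^1,\dots,e^n$ be the dual basis, and write $e^{i_1\dots i_q}=e^{i_1}\wedge\dots\wedge e^{i_q}$. Let $d$ be the derivation of the exterior algebra $\Lambda(\mathfrak m_0(n)^*)$ with $(d\xi)(X,Y)=\xi([X,Y])$ for one-forms $\xi$, and let $H^3(\mathfrak m_0(n))=\ker(d|_{\Lambda^3})/d(\Lambda^2)$. For all $n$, regard $\Lambda(\mathfrak m_0(n)^*)$ as the subalgebra generated by $e^1,\dots,e^n$ of the exterior algebra $\Lambda$ over $\mathbb F_2$ on generators $e^1,e^2,e^3,\dots$. Let $D$ be the derivation of $\Lambda$ with $De^1=De^2=0$ and $De^i=e^{i-1}$ for $i\ge 3$, and for $\omega\in\Lambda$, $i \ge 1$ put $$F(\omega,e^i)=\sum_{l\ge 0}D^l\omega\wedge e^{i+l+1},$$ which is a finite sum. For $t\ge 4$ write $t=2^p+m$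 with $0<m\le 2^p$ (this determines $p$ and $m$), and for $2\le k\le m$ put $a=\lceil (t+2k+1)/3\rceil$, $b=\lfloor t/2\rfloor+k-1$ and $$\beta_{t,k}=\sum_{r=a}^{b}\ \sum_{s=0}^{p-1}\binom{m-k}{t-r-2^s}\,F\big(e^{t+2k-2r}\wedge e^{r},\,e^r\big),$$ where the binomial coefficients are taken modulo $2$ and $\binom{N}{j}=0$ if $j<0$ or $j>N$. Let $B_t=\{\beta_{t,k}: 2\le k\le m\}$. Then, for every $n\ge 4$: each element of $B_t$, $4\le t\le n$, lies in $\Lambda^3(\mathfrak m_0(t)^*)$; the forms $e^{1,i-1,i}$ with $2+\lfloor n/2\rfloor\le i\le n$, together with the forms $\beta_{t,k}$ with $4\le t\le n$ and $2\le k\le m$ (where $t=2^p+m$, $0<m\le 2^p$), that is, the elements of $\bigcup_{4\le t\le n}B_t$, are $3$-cocycles of $\mathfrak m_0(n)$; and their cohomology classes, indexed by these $i$ and these pairs $(t,k)$, form a basis of $H^3(\mathfrak m_0(n))$ over $\mathbb F_2$. -/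

import Mathlib

namespace MaxClass

noncomputable section

section Derivation

variable {V : Type} [AddCommGroup V] [Module (ZMod 2) V]

/-- Over the field with two elements the exterior algebra is commutative. -/
theorem ext_mul_comm (x y : ExteriorAlgebra (ZMod 2) V) : x * y = y * x := by
  have h2 : ∀ z : ExteriorAlgebra (ZMod 2) V, z + z = 0 := fun z => by
    rw [← two_smul (ZMod 2) z, show (2 : ZMod 2) = 0 from by decide, zero_smul]
  induction x using ExteriorAlgebra.induction with
  | algebraMap r => exact Algebra.commutes r y
  | add a b ha hb => rw [add_mul, mul_add, ha, hb]
  | mul a b ha hb => rw [mul_assoc, hb, ← mul_assoc, ha, mul_assoc]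
  | ι v =>
    induction y using ExteriorAlgebra.induction with
    | algebraMap r => exact (Algebra.commutes r _).symm
    | add a b ha hb => rw [add_mul, mul_add, ha, hb]
    | mul a b ha hb => rw [← mul_assoc, ha, mul_assoc, hb, mul_assoc]
    | ι w =>
      have h := ExteriorAlgebra.ι_add_mul_swap (R := ZMod 2) v w
      exact add_right_cancel (h.trans (h2 _).symm)

/-- The algebra map `v ↦ v + ε f(v)` into the dual numbers over the exterior algebra. -/
def derivLift (f : V →ₗ[ZMod 2] ExteriorAlgebra (ZMod 2) V) :
    ExteriorAlgebra (ZMod 2) V →ₐ[ZMod 2]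
      TrivSqZeroExt (ExteriorAlgebra (ZMod 2) V) (ExteriorAlgebra (ZMod 2) V) :=
  ExteriorAlgebra.lift (ZMod 2)
    ⟨{ toFun := fun v => TrivSqZeroExt.inl (ExteriorAlgebra.ι (ZMod 2) v) + TrivSqZeroExt.inr (f v)
       map_add' := fun v w => by
         refine TrivSqZeroExt.ext ?_ ?_ <;> simp
       map_smul' := fun r v => by
         refine TrivSqZeroExt.ext ?_ ?_ <;> simp }, fun v => by
      have h2 : ∀ z : ExteriorAlgebra (ZMod 2) V, z + z = 0 := fun z => by
        rw [← two_smul (ZMod 2) z, show (2 : ZMod 2) = 0 from by decide, zero_smul]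
      refine TrivSqZeroExt.ext ?_ ?_
      · simp
      · simp [ext_mul_comm (f v), h2]⟩

/-- The derivation of the exterior algebra (over the field with two elements, so that
`D (x ∧ y) = D x ∧ y + x ∧ D y` without signs) which extends a linear map `f` defined on the
generators; see `extDeriv_ι` and `extDeriv_mul`. -/
def extDeriv (f : V →ₗ[ZMod 2] ExteriorAlgebra (ZMod 2) V) :
    ExteriorAlgebra (ZMod 2) V →ₗ[ZMod 2] ExteriorAlgebra (ZMod 2) V where
  toFun x := (derivLift f x).snd
  map_add' x y := by rw [map_add, TrivSqZeroExt.snd_add]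
  map_smul' r x := by rw [map_smul, TrivSqZeroExt.snd_smul, RingHom.id_apply]

theorem extDeriv_ι (f : V →ₗ[ZMod 2] ExteriorAlgebra (ZMod 2) V) (v : V) :
    extDeriv f (ExteriorAlgebra.ι (ZMod 2) v) = f v := by
  change (derivLift f _).snd = _
  rw [derivLift, ExteriorAlgebra.lift_ι_apply]
  simp

theorem fst_derivLift (f : V →ₗ[ZMod 2] ExteriorAlgebra (ZMod 2) V)
    (x : ExteriorAlgebra (ZMod 2) V) : (derivLift f x).fst = x := by
  have h : (TrivSqZeroExt.fstHom (ZMod 2) (ExteriorAlgebra (ZMod 2) V)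
      (ExteriorAlgebra (ZMod 2) V)).comp (derivLift f) = AlgHom.id _ _ := by
    apply ExteriorAlgebra.hom_ext
    ext v
    simp only [LinearMap.comp_apply, AlgHom.toLinearMap_apply, AlgHom.comp_apply, derivLift,
      ExteriorAlgebra.lift_ι_apply]
    simp
  exact DFunLike.congr_fun h x

theorem extDeriv_mul (f : V →ₗ[ZMod 2] ExteriorAlgebra (ZMod 2) V)
    (x y : ExteriorAlgebra (ZMod 2) V) :
    extDeriv f (x * y) = extDeriv f x * y + x * extDeriv f y := by
  change (derivLift f (x * y)).snd = (derivLift f x).snd * y + x * (derivLift f y).snd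
  rw [map_mul, TrivSqZeroExt.snd_mul, fst_derivLift, fst_derivLift, add_comm]
  rfl

theorem extDeriv_algebraMap (f : V →ₗ[ZMod 2] ExteriorAlgebra (ZMod 2) V) (r : ZMod 2) :
    extDeriv f (algebraMap (ZMod 2) _ r) = 0 := by
  change (derivLift f _).snd = 0
  rw [AlgHom.commutes]
  rfl

end Derivation

section Cohomology

open ExteriorAlgebra

variable {L κ : Type} [LieRing L] [LieAlgebra (ZMod 2) L] [Fintype κ] [LinearOrder κ]

/-- The differential of a one-form: `d ξ = ∑_{i < j} ξ([b_i, b_j]) b^i ∧ b^j`, that is, the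
two-form `(X, Y) ↦ ξ([X, Y])`; see `contract_dOne`. -/
def dOne (b : Module.Basis κ (ZMod 2) L) :
    Module.Dual (ZMod 2) L →ₗ[ZMod 2] ExteriorAlgebra (ZMod 2) (Module.Dual (ZMod 2) L) :=
  ∑ p ∈ (Finset.univ : Finset (κ × κ)).filter (fun p => p.1 < p.2),
    (LinearMap.toSpanSingleton (ZMod 2) _
      (ι (ZMod 2) (b.coord p.1) * ι (ZMod 2) (b.coord p.2))) ∘ₗ
        Module.Dual.eval (ZMod 2) L ⁅b p.1, b p.2⁆

/-- The Chevalley-Eilenberg differential (trivial coefficients, field with two elements) on the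
exterior algebra of the dual of `L`: the derivation which extends `dOne`. -/
def ceD (b : Module.Basis κ (ZMod 2) L) :
    ExteriorAlgebra (ZMod 2) (Module.Dual (ZMod 2) L) →ₗ[ZMod 2]
      ExteriorAlgebra (ZMod 2) (Module.Dual (ZMod 2) L) :=
  extDeriv (dOne b)

/-- `d ξ` evaluated at `X`, `Y` (contraction first with `X`, then with `Y`) is `ξ([X, Y])`; in
particular the differential does not depend on the basis. -/
theorem contract_dOne (b : Module.Basis κ (ZMod 2) L) (ξ : Module.Dual (ZMod 2) L) (X Y : L) :
    CliffordAlgebra.contractLeft (Q := 0) (Module.Dual.eval (ZMod 2) L Y)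
      (CliffordAlgebra.contractLeft (Q := 0) (Module.Dual.eval (ZMod 2) L X)
        (ceD b (ι (ZMod 2) ξ))) =
      algebraMap (ZMod 2) (ExteriorAlgebra (ZMod 2) (Module.Dual (ZMod 2) L)) (ξ ⁅X, Y⁆) := by
  have h2 : ∀ α β : Module.Dual (ZMod 2) L,
      CliffordAlgebra.contractLeft (Q := 0) (Module.Dual.eval (ZMod 2) L Y)
        (CliffordAlgebra.contractLeft (Q := 0) (Module.Dual.eval (ZMod 2) L X)
          (ι (ZMod 2) α * ι (ZMod 2) β)) =
      algebraMap (ZMod 2) (ExteriorAlgebra (ZMod 2) (Module.Dual (ZMod 2) L))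
        (α X * β Y - β X * α Y) := by
    intro α β
    change CliffordAlgebra.contractLeft (Q := 0) _ (CliffordAlgebra.contractLeft (Q := 0) _
      (CliffordAlgebra.ι 0 α * CliffordAlgebra.ι 0 β)) = _
    rw [CliffordAlgebra.contractLeft_ι_mul, CliffordAlgebra.contractLeft_ι, map_sub, map_smul,
      CliffordAlgebra.contractLeft_ι, CliffordAlgebra.contractLeft_mul_algebraMap,
      CliffordAlgebra.contractLeft_ι]
    simp only [Module.Dual.eval_apply, map_sub, map_mul, Algebra.smul_def]
    congr 1
    rw [← map_mul, ← map_mul, mul_comm]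
  have hsplit : ∀ G : κ → κ → ZMod 2, (∀ i, G i i = 0) →
      ∑ i, ∑ j, G i j = ∑ p ∈ (Finset.univ : Finset (κ × κ)).filter (fun p => p.1 < p.2),
        (G p.1 p.2 + G p.2 p.1) := by
    intro G hG
    rw [Finset.sum_filter, Fintype.sum_prod_type]
    have hs : ∑ i, ∑ j, (if i < j then G j i else 0) = ∑ i, ∑ j, (if j < i then G i j else 0) :=
      Finset.sum_comm
    have : ∀ i j : κ, (if i < j then G i j + G j i else 0) =
        (if i < j then G i j else 0) + (if i < j then G j i else 0) := fun i j => by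
      split_ifs <;> simp
    simp only [this, Finset.sum_add_distrib, hs]
    simp only [← Finset.sum_add_distrib]
    refine Finset.sum_congr rfl fun i _ => Finset.sum_congr rfl fun j _ => ?_
    rcases lt_trichotomy i j with h | rfl | h
    · simp [h, h.not_gt]
    · simp [hG]
    · simp [h, h.not_gt]
  have hbr : ξ ⁅X, Y⁆ = ∑ i, ∑ j, b.coord i X * b.coord j Y * ξ ⁅b i, b j⁆ := by
    conv_lhs => rw [← b.sum_repr X, ← b.sum_repr Y]
    simp only [sum_lie, lie_sum, smul_lie, lie_smul, map_sum,
      map_smul, smul_eq_mul, Module.Basis.coord_apply, Finset.mul_sum, mul_assoc]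
    rw [Finset.sum_comm]
    refine Finset.sum_congr rfl fun i _ => Finset.sum_congr rfl fun j _ => ?_
    ring
  rw [hbr, hsplit _ (fun i => by simp), ceD, extDeriv_ι, dOne, LinearMap.sum_apply]
  simp only [LinearMap.comp_apply, Module.Dual.eval_apply, LinearMap.toSpanSingleton_apply,
    map_sum, map_smul]
  refine Finset.sum_congr rfl fun p _ => ?_
  rw [h2, ← lie_skew (b p.1) (b p.2), map_neg, Algebra.smul_def, ← map_mul]
  congr 1
  ring

/-- The differential raises the degree of a form by one. -/
theorem ceD_mem (b : Module.Basis κ (ZMod 2) L) (q : ℕ) :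
    ∀ x ∈ ⋀[ZMod 2]^q (Module.Dual (ZMod 2) L), ceD b x ∈ ⋀[ZMod 2]^(q + 1)
      (Module.Dual (ZMod 2) L) := by
  have hι : ∀ v : Module.Dual (ZMod 2) L, ι (ZMod 2) v ∈
      LinearMap.range (ι (ZMod 2) : Module.Dual (ZMod 2) L →ₗ[ZMod 2] _) := fun v => ⟨v, rfl⟩
  induction q with
  | zero =>
    intro x hx
    rw [exteriorPower, pow_zero, Submodule.mem_one] at hx
    obtain ⟨r, rfl⟩ := hx
    rw [ceD, extDeriv_algebraMap]
    exact Submodule.zero_mem _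
  | succ q ih =>
    intro x hx
    rw [exteriorPower, pow_succ] at hx
    induction hx using Submodule.mul_induction_on' with
    | mem_mul_mem y hy z hz =>
      obtain ⟨v, rfl⟩ := hz
      rw [ceD, extDeriv_mul, exteriorPower]
      refine Submodule.add_mem _ ?_ ?_
      · rw [pow_succ]
        exact Submodule.mul_mem_mul (ih y hy) (hι v)
      · rw [add_assoc, pow_add]
        refine Submodule.mul_mem_mul hy ?_
        rw [extDeriv_ι, dOne, LinearMap.sum_apply]
        refine Submodule.sum_mem _ fun p _ => ?_
        rw [LinearMap.comp_apply, LinearMap.toSpanSingleton_apply, pow_succ, pow_one]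
        exact Submodule.smul_mem _ _ (Submodule.mul_mem_mul (hι _) (hι _))
    | add y hy z hz h1 h2 =>
      rw [map_add]
      exact Submodule.add_mem _ h1 h2

/-- The `q`-cocycles: the `q`-forms killed by the differential. -/
def cocycles (b : Module.Basis κ (ZMod 2) L) (q : ℕ) :
    Submodule (ZMod 2) (ExteriorAlgebra (ZMod 2) (Module.Dual (ZMod 2) L)) :=
  (⋀[ZMod 2]^q (Module.Dual (ZMod 2) L)) ⊓ LinearMap.ker (ceD b)

/-- The `q`-coboundaries: the differentials of the `(q - 1)`-forms. -/
def coboundaries (b : Module.Basis κ (ZMod 2) L) : ℕ →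
    Submodule (ZMod 2) (ExteriorAlgebra (ZMod 2) (Module.Dual (ZMod 2) L))
  | 0 => ⊥
  | q + 1 => (⋀[ZMod 2]^q (Module.Dual (ZMod 2) L)).map (ceD b)

/-- The cohomology space `H^q(L)`, cocycles modulo coboundaries. -/
abbrev cohomology (b : Module.Basis κ (ZMod 2) L) (q : ℕ) : Type :=
  cocycles b q ⧸ (coboundaries b q).submoduleOf (cocycles b q)

end Cohomology

/-- The underlying space of the Lie algebra `m_0(n)` over the field with two elements:
coordinate vectors indexed by `1, …, n`. -/
def M0 (n : ℕ) : Type := Finset.Icc 1 n → ZMod 2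

namespace M0

variable {n : ℕ}

instance : AddCommGroup (M0 n) := inferInstanceAs (AddCommGroup (Finset.Icc 1 n → ZMod 2))

instance : Module (ZMod 2) (M0 n) :=
  inferInstanceAs (Module (ZMod 2) (Finset.Icc 1 n → ZMod 2))

/-- The `i`-th coordinate, zero when `i` is not one of `1, …, n`. -/
def co (i : ℕ) : M0 n →ₗ[ZMod 2] ZMod 2 where
  toFun x := if h : i ∈ Finset.Icc 1 n then x ⟨i, h⟩ else 0
  map_add' x y := by
    by_cases h : i ∈ Finset.Icc 1 n
    · simp only [dif_pos h]; rfl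
    · simp only [dif_neg h, add_zero]
  map_smul' r x := by
    by_cases h : i ∈ Finset.Icc 1 n
    · simp only [dif_pos h]; rfl
    · simp only [dif_neg h, smul_zero]

/-- The basis `e_1, …, e_n`. -/
def basis (n : ℕ) : Module.Basis (Finset.Icc 1 n) (ZMod 2) (M0 n) :=
  Module.Basis.ofEquivFun
    { toFun := fun x j => x j
      invFun := fun x j => x j
      map_add' := fun _ _ => rfl
      map_smul' := fun _ _ => rfl }

/-- The bracket with `[e_1, e_i] = - [e_i, e_1] = e_{i+1}` for `2 ≤ i ≤ n - 1`, and all other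
brackets of basis vectors equal to zero. -/
instance : Bracket (M0 n) (M0 n) where
  bracket x y := fun j : Finset.Icc 1 n =>
    if 3 ≤ (j : ℕ) then co 1 x * co ((j : ℕ) - 1) y - co 1 y * co ((j : ℕ) - 1) x else 0

theorem co_apply (x : M0 n) (j : Finset.Icc 1 n) : co (j : ℕ) x = x j := by
  change dite _ _ _ = _
  rw [dif_pos j.2]

theorem ext_pt {x y : M0 n} (h : ∀ j : Finset.Icc 1 n, x j = y j) : x = y := funext h

theorem bracket_apply (x y : M0 n) (j : Finset.Icc 1 n) : ⁅x, y⁆ j =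
    if 3 ≤ (j : ℕ) then co 1 x * co ((j : ℕ) - 1) y - co 1 y * co ((j : ℕ) - 1) x else 0 := rfl

theorem co_one_bracket (x y : M0 n) : co 1 ⁅x, y⁆ = 0 := by
  by_cases h : 1 ∈ Finset.Icc 1 n
  · exact co_apply ⁅x, y⁆ ⟨1, h⟩
  · exact dif_neg h

theorem co_bracket (x y : M0 n) (j : ℕ) (hj : j ∈ Finset.Icc 1 n) : co j ⁅x, y⁆ =
    if 3 ≤ j then co 1 x * co (j - 1) y - co 1 y * co (j - 1) x else 0 :=
  co_apply ⁅x, y⁆ ⟨j, hj⟩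

instance : LieRing (M0 n) where
  add_lie x y z := by
    refine ext_pt fun j => ?_
    change _ = ⁅x, z⁆ j + ⁅y, z⁆ j
    simp only [bracket_apply, map_add]
    split_ifs <;> ring
  lie_add x y z := by
    refine ext_pt fun j => ?_
    change _ = ⁅x, y⁆ j + ⁅x, z⁆ j
    simp only [bracket_apply, map_add]
    split_ifs <;> ring
  lie_self x := by
    refine ext_pt fun j => ?_
    change _ = (0 : ZMod 2)
    rw [bracket_apply]
    split_ifs <;> ring
  leibniz_lie x y z := by
    refine ext_pt fun j => ?_
    change _ = ⁅⁅x, y⁆, z⁆ j + ⁅y, ⁅x, z⁆⁆ j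
    have hj := Finset.mem_Icc.mp j.2
    simp only [bracket_apply, co_one_bracket]
    by_cases h : 3 ≤ (j : ℕ)
    · have hm : (j : ℕ) - 1 ∈ Finset.Icc 1 n := Finset.mem_Icc.mpr (by omega)
      simp only [if_pos h, co_bracket _ _ _ hm]
      split_ifs <;> ring
    · simp [h]

instance : LieAlgebra (ZMod 2) (M0 n) where
  lie_smul r x y := by
    refine ext_pt fun j => ?_
    change _ = r * ⁅x, y⁆ j
    simp only [bracket_apply, map_smul, smul_eq_mul]
    split_ifs <;> ring

/-- The vector `e_i`, read as zero when `i` is not one of `1, …, n`. -/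
def e (n i : ℕ) : M0 n := if h : i ∈ Finset.Icc 1 n then basis n ⟨i, h⟩ else 0

theorem basis_apply (i j : Finset.Icc 1 n) : basis n i j = if j = i then 1 else 0 := by
  rw [basis, Module.Basis.coe_ofEquivFun]
  exact Pi.single_apply i (1 : ZMod 2) j

theorem basis_coord (i : Finset.Icc 1 n) : (basis n).coord i = co (i : ℕ) := by
  ext x
  rw [co_apply]
  rfl

theorem co_e (i j : ℕ) (hj : j ∈ Finset.Icc 1 n) : co j (e n i) = if j = i then 1 else 0 := by
  rw [show co j (e n i) = e n i ⟨j, hj⟩ from co_apply (e n i) ⟨j, hj⟩, e]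
  by_cases hi : i ∈ Finset.Icc 1 n
  · rw [dif_pos hi, basis_apply]
    simp
  · rw [dif_neg hi, if_neg (fun h : j = i => hi (h ▸ hj))]
    rfl

theorem ext_co {x y : M0 n} (h : ∀ j ∈ Finset.Icc 1 n, co j x = co j y) : x = y :=
  ext_pt fun j => by
    have := h j j.2
    rwa [co_apply, co_apply] at this

theorem lie_e_one (i : ℕ) (h : 2 ≤ i) : ⁅e n 1, e n i⁆ = e n (i + 1) := by
  refine ext_co fun j hm => ?_
  have hj := Finset.mem_Icc.mp hm
  rw [co_bracket _ _ _ hm, co_e _ _ hm]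
  by_cases h3 : 3 ≤ j
  · rw [if_pos h3, co_e _ _ (Finset.mem_Icc.mpr (by omega)),
      co_e _ _ (Finset.mem_Icc.mpr (by omega)), co_e _ _ (Finset.mem_Icc.mpr (by omega)),
      co_e _ _ (Finset.mem_Icc.mpr (by omega)), if_pos rfl, if_neg (show ¬ 1 = i by omega)]
    by_cases hji : j = i + 1
    · rw [if_pos hji, if_pos (by omega)]; ring
    · rw [if_neg hji, if_neg (by omega)]; ring
  · rw [if_neg h3, if_neg (by omega)]

theorem lie_e_e (i j : ℕ) (hi : 2 ≤ i) (hj : 2 ≤ j) : ⁅e n i, e n j⁆ = 0 := by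
  refine ext_co fun l hm => ?_
  have hl := Finset.mem_Icc.mp hm
  rw [map_zero, co_bracket _ _ _ hm, co_e i 1 (Finset.mem_Icc.mpr (by omega)),
    co_e j 1 (Finset.mem_Icc.mpr (by omega)), if_neg (show ¬ 1 = i by omega), if_neg (show ¬ 1 = j by omega)]
  simp only [zero_mul, sub_zero, ite_self]

/-- The one-form `e^i` on `m_0(n)`, read as zero when `i` is not one of `1, …, n`. -/
def form (n i : ℕ) : ExteriorAlgebra (ZMod 2) (Module.Dual (ZMod 2) (M0 n)) :=
  ExteriorAlgebra.ι (ZMod 2) (co i)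

theorem ceD_form (i : ℕ) (hi : i ≤ n) : ceD (basis n) (form n i) =
    if 3 ≤ i then form n 1 * form n (i - 1) else 0 := by
  rw [ceD, form, extDeriv_ι, dOne, LinearMap.sum_apply]
  simp only [LinearMap.comp_apply, Module.Dual.eval_apply, LinearMap.toSpanSingleton_apply,
    basis_coord]
  rcases Nat.eq_zero_or_pos i with rfl | h0
  · rw [if_neg (by omega)]
    refine Finset.sum_eq_zero fun p _ => ?_
    rw [show (co 0 : M0 n →ₗ[ZMod 2] ZMod 2) ⁅basis n p.1, basis n p.2⁆ = 0 from
      dif_neg (by simp), zero_smul]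
  have hi' : i ∈ Finset.Icc 1 n := Finset.mem_Icc.mpr (by omega)
  by_cases h3 : 3 ≤ i
  · have h1 : 1 ∈ Finset.Icc 1 n := Finset.mem_Icc.mpr (by omega)
    have h2 : i - 1 ∈ Finset.Icc 1 n := Finset.mem_Icc.mpr (by omega)
    have hco : ∀ (j : ℕ) (hj : j ∈ Finset.Icc 1 n) (q : Finset.Icc 1 n),
        co j (basis n q) = if j = (q : ℕ) then 1 else 0 := fun j hj q => by
      rw [← co_e _ _ hj, e, dif_pos q.2]
    rw [if_pos h3, Finset.sum_eq_single ((⟨1, h1⟩, ⟨i - 1, h2⟩) :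
      Finset.Icc 1 n × Finset.Icc 1 n)]
    · rw [co_bracket _ _ _ hi', if_pos h3, hco _ h1, hco _ h2, hco _ h1, hco _ h2]
      rw [if_pos rfl, if_pos rfl, if_neg (show ¬ 1 = i - 1 by omega)]
      simp [form]
    · intro p hp hne
      have hlt : (p.1 : ℕ) < (p.2 : ℕ) := (Finset.mem_filter.mp hp).2
      have hp1 := (Finset.mem_Icc.mp p.1.2).1
      rw [co_bracket _ _ _ hi', if_pos h3, hco _ h1, hco _ h2, hco _ h1, hco _ h2,
        if_neg (show ¬ 1 = (p.2 : ℕ) by omega)]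
      have : ¬ (1 = (p.1 : ℕ) ∧ i - 1 = (p.2 : ℕ)) := fun h =>
        hne (Prod.ext (Subtype.ext h.1.symm) (Subtype.ext h.2.symm))
      by_cases hq : 1 = (p.1 : ℕ)
      · rw [if_neg (show ¬ i - 1 = (p.2 : ℕ) from fun h => this ⟨hq, h⟩)]; simp
      · rw [if_neg hq]; simp
    · intro h
      refine absurd (Finset.mem_filter.mpr ⟨Finset.mem_univ _, ?_⟩) h
      exact show 1 < i - 1 by omega
  · rw [if_neg h3]
    refine Finset.sum_eq_zero fun p _ => ?_
    rw [co_bracket _ _ _ hi', if_neg h3, zero_smul]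

theorem ceD_ceD (x : ExteriorAlgebra (ZMod 2) (Module.Dual (ZMod 2) (M0 n))) :
    ceD (basis n) (ceD (basis n) x) = 0 := by
  have h2 : ∀ z : ExteriorAlgebra (ZMod 2) (Module.Dual (ZMod 2) (M0 n)), z + z = 0 := fun z => by
    rw [← two_smul (ZMod 2) z, show (2 : ZMod 2) = 0 from by decide, zero_smul]
  have hm : ∀ y z, ceD (basis n) (y * z) = ceD (basis n) y * z + y * ceD (basis n) z :=
    fun y z => extDeriv_mul _ y z
  have hf : ∀ i, i ≤ n → ceD (basis n) (ceD (basis n) (form n i)) = 0 := by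
    intro i hi
    rw [ceD_form i hi]
    split_ifs with h3
    · have hsq : form n 1 * form n 1 = 0 := ExteriorAlgebra.ι_sq_zero _
      rw [hm, ceD_form 1 (by omega), ceD_form (i - 1) (by omega)]
      split_ifs
      · omega
      · omega
      · rw [← mul_assoc, hsq]; simp
      · simp
    · exact map_zero _
  induction x using ExteriorAlgebra.induction with
  | algebraMap r => rw [ceD, extDeriv_algebraMap, map_zero]
  | add x y hx hy => rw [map_add, map_add, hx, hy, add_zero]
  | mul x y hx hy =>
    rw [hm, map_add, hm, hm, hx, hy, zero_mul, mul_zero, zero_add, add_zero, h2]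
  | ι ξ =>
    rw [← (basis n).sum_dual_apply_smul_coord ξ]
    simp only [map_sum, map_smul, basis_coord]
    refine Finset.sum_eq_zero fun i _ => ?_
    have := hf i (Finset.mem_Icc.mp i.2).2
    rw [form] at this
    rw [this, smul_zero]

theorem coboundaries_le_cocycles (q : ℕ) :
    coboundaries (basis n) q ≤ cocycles (basis n) q := by
  cases q with
  | zero => exact bot_le
  | succ q =>
    rintro _ ⟨x, hx, rfl⟩
    exact ⟨ceD_mem _ q x hx, ceD_ceD x⟩

end M0

/-- The exterior algebra on generators `e^1, e^2, e^3, …` over the field with two elements (the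
cochains of the infinite-dimensional algebra `m_0`). -/
abbrev Forms : Type := ExteriorAlgebra (ZMod 2) (ℕ+ →₀ ZMod 2)

/-- The one-form `e^i`, with the convention `e^0 = 0`. -/
def ee (i : ℕ) : Forms :=
  if h : 0 < i then ExteriorAlgebra.ι (ZMod 2) (Finsupp.single (Nat.toPNat i h) 1) else 0

/-- The derivation `D` with `D e^1 = D e^2 = 0` and `D e^i = e^{i-1}` for `i ≥ 3`. -/
def D : Forms →ₗ[ZMod 2] Forms :=
  extDeriv (Finsupp.linearCombination (ZMod 2)
    (fun i : ℕ+ => if 3 ≤ (i : ℕ) then ee ((i : ℕ) - 1) else 0))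

theorem D_ee (i : ℕ) : D (ee i) = if 3 ≤ i then ee (i - 1) else 0 := by
  rcases Nat.eq_zero_or_pos i with rfl | h
  · simp [ee]
  · have hi : ((Nat.toPNat i h : ℕ+) : ℕ) = i := rfl
    rw [ee, dif_pos h, D, extDeriv_ι, Finsupp.linearCombination_single, one_smul, hi]

/-- `D` is locally nilpotent. -/
theorem D_nilpotent (ω : Forms) : ∃ N : ℕ, (D ^ N) ω = 0 := by
  have hle : ∀ (x : Forms) (a b : ℕ), a ≤ b → (D ^ a) x = 0 → (D ^ b) x = 0 := by
    intro x a b hab h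
    obtain ⟨c, rfl⟩ := Nat.exists_eq_add_of_le hab
    rw [add_comm, pow_add, Module.End.mul_apply, h, map_zero]
  have hmul : ∀ (N a b : ℕ) (x y : Forms), a + b ≤ N → (D ^ a) x = 0 → (D ^ b) y = 0 →
      (D ^ N) (x * y) = 0 := by
    intro N
    induction N with
    | zero =>
      intro a b x y hab hx hy
      obtain rfl : a = 0 := by omega
      have hx' : x = 0 := by simpa using hx
      simp [hx']
    | succ N ih =>
      intro a b x y hab hx hy
      rcases Nat.eq_zero_or_pos a with rfl | ha
      · have hx' : x = 0 := by simpa using hx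
        simp [hx']
      rcases Nat.eq_zero_or_pos b with rfl | hb
      · have hy' : y = 0 := by simpa using hy
        simp [hy']
      obtain ⟨a, rfl⟩ := Nat.exists_eq_add_of_le' ha
      obtain ⟨b, rfl⟩ := Nat.exists_eq_add_of_le' hb
      have hD : D (x * y) = D x * y + x * D y := extDeriv_mul _ x y
      rw [pow_succ, Module.End.mul_apply, hD, map_add,
        ih a (b + 1) (D x) y (by omega) (by rwa [pow_succ, Module.End.mul_apply] at hx) hy,
        ih (a + 1) b x (D y) (by omega) hx (by rwa [pow_succ, Module.End.mul_apply] at hy),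
        add_zero]
  have hee : ∀ i : ℕ, (D ^ i) (ee i) = 0 := by
    intro i
    induction i with
    | zero => simp [ee]
    | succ i ih =>
      rw [pow_succ, Module.End.mul_apply, D_ee]
      split_ifs
      · simpa using ih
      · rw [map_zero]
  induction ω using ExteriorAlgebra.induction with
  | algebraMap r => exact ⟨1, by rw [pow_one]; exact extDeriv_algebraMap _ r⟩
  | add x y hx hy =>
    obtain ⟨a, ha⟩ := hx
    obtain ⟨b, hb⟩ := hy
    exact ⟨a + b, by rw [map_add, hle x a _ (by omega) ha, hle y b _ (by omega) hb, add_zero]⟩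
  | mul x y hx hy =>
    obtain ⟨a, ha⟩ := hx
    obtain ⟨b, hb⟩ := hy
    exact ⟨a + b, hmul _ a b x y le_rfl ha hb⟩
  | ι v =>
    induction v using Finsupp.induction_linear with
    | zero => exact ⟨0, by simp⟩
    | add x y hx hy =>
      obtain ⟨a, ha⟩ := hx
      obtain ⟨b, hb⟩ := hy
      exact ⟨a + b, by
        rw [map_add, map_add, hle _ a _ (by omega) ha, hle _ b _ (by omega) hb, add_zero]⟩
    | single i r =>
      refine ⟨i, ?_⟩
      have h : ExteriorAlgebra.ι (ZMod 2) (Finsupp.single i r) = r • ee (i : ℕ) := by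
        rw [ee, dif_pos i.pos, ← map_smul, Finsupp.smul_single, smul_eq_mul, mul_one]
        rfl
      rw [h, map_smul, hee, smul_zero]

/-- `F(ω, e^i) = ∑_{l ≥ 0} D^l ω ∧ e^{i+l+1}`, a finite sum by `D_nilpotent`. -/
def F (ω : Forms) (i : ℕ) : Forms := ∑ᶠ l : ℕ, (D ^ l) ω * ee (i + l + 1)

/-- The sum in the definition of `F` has finitely many nonzero terms. -/
theorem F_support (ω : Forms) (i : ℕ) :
    (Function.support fun l : ℕ => (D ^ l) ω * ee (i + l + 1)).Finite := by
  obtain ⟨N, hN⟩ := D_nilpotent ω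
  refine (Set.finite_Iio N).subset fun l hl => ?_
  by_contra h
  obtain ⟨c, rfl⟩ := Nat.exists_eq_add_of_le (not_lt.mp h)
  exact hl (by
    change (D ^ (N + c)) ω * _ = 0
    rw [add_comm N c, pow_add, Module.End.mul_apply, hN, map_zero, zero_mul])

/-- The binomial coefficient with an integer lower entry, zero when that entry is negative. -/
def binom (N : ℕ) (t : ℤ) : ℕ := if 0 ≤ t then N.choose t.toNat else 0

/-- The exponent `p` in `n = 2^p + m`, `0 < m ≤ 2^p`. -/
def pOf (n : ℕ) : ℕ := Nat.log 2 (n - 1)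

/-- The number `m` in `n = 2^p + m`, `0 < m ≤ 2^p`. -/
def mOf (n : ℕ) : ℕ := n - 2 ^ pOf n

theorem pOf_mOf_iff (n : ℕ) (hn : 2 ≤ n) (p m : ℕ) :
    (n = 2 ^ p + m ∧ 0 < m ∧ m ≤ 2 ^ p) ↔ p = pOf n ∧ m = mOf n := by
  constructor
  · rintro ⟨h, h0, h1⟩
    have hp : pOf n = p := Nat.log_eq_of_pow_le_of_lt_pow (by omega) (by rw [pow_succ]; omega)
    exact ⟨hp.symm, by rw [mOf, hp]; omega⟩
  · rintro ⟨rfl, rfl⟩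
    have h0 : 2 ^ pOf n ≤ n - 1 := Nat.pow_log_le_self 2 (by omega)
    have h1 : n - 1 < 2 ^ (pOf n + 1) := Nat.lt_pow_succ_log_self (by omega) _
    rw [pow_succ] at h1
    rw [mOf]
    omega

/-- The elements of the set `B_n`: for `2 ≤ k ≤ m`, with `a = ⌈(n+2k+1)/3⌉` and
`b = ⌊n/2⌋ + k - 1`, the form
`∑_{r=a}^{b} ∑_{s=0}^{p-1} binom(m-k, n-r-2^s) F(e^{n+2k-2r} ∧ e^r, e^r)`.
For `r ≤ b` one has `n + 2k - 2r ≥ 2`, so this subtraction never truncates. -/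
def beta (n k : ℕ) : Forms :=
  ∑ r ∈ Finset.Icc ⌈((n + 2 * k + 1 : ℕ) : ℚ) / 3⌉₊ (n / 2 + k - 1),
    ∑ s ∈ Finset.range (pOf n),
      (binom (mOf n - k) ((n : ℤ) - r - 2 ^ s) : ZMod 2) •
        F (ee (n + 2 * k - 2 * r) * ee r) r

/-- The inclusion of the forms on `m_0(n)` into the forms in `e^1, e^2, …`, sending `e^i` to
`e^i` for `1 ≤ i ≤ n`. -/
def incl (n : ℕ) :
    ExteriorAlgebra (ZMod 2) (Module.Dual (ZMod 2) (M0 n)) →ₐ[ZMod 2] Forms :=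
  ExteriorAlgebra.map (∑ i : Finset.Icc 1 n,
    (Finsupp.lsingle (Nat.toPNat (i : ℕ) (Finset.mem_Icc.mp i.2).1)) ∘ₗ
      Module.Dual.eval (ZMod 2) (M0 n) (M0.basis n i))

theorem incl_form (n i : ℕ) (hi : i ≤ n) : incl n (M0.form n i) = ee i := by
  rw [incl, M0.form, ExteriorAlgebra.map_apply_ι, LinearMap.sum_apply]
  simp only [LinearMap.comp_apply, Module.Dual.eval_apply]
  rcases Nat.eq_zero_or_pos i with rfl | h0
  · rw [ee, dif_neg (by omega), Finset.sum_eq_zero, map_zero]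
    intro j _
    rw [show (M0.co 0 : M0 n →ₗ[ZMod 2] ZMod 2) (M0.basis n j) = 0 from dif_neg (by simp),
      map_zero]
  · have hi' : i ∈ Finset.Icc 1 n := Finset.mem_Icc.mpr (by omega)
    have hco : ∀ q : Finset.Icc 1 n, M0.co i (M0.basis n q) = if i = (q : ℕ) then 1 else 0 :=
      fun q => by rw [← M0.co_e _ _ hi', M0.e, dif_pos q.2]
    rw [Finset.sum_eq_single (⟨i, hi'⟩ : Finset.Icc 1 n), hco, if_pos rfl, ee, dif_pos h0]
    · rfl
    · intro q _ hq
      rw [hco, if_neg (fun h => hq (Subtype.ext h.symm)), map_zero]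
    · intro h
      exact absurd (Finset.mem_univ _) h

theorem incl_injective (n : ℕ) : Function.Injective (incl n) := by
  refine ExteriorAlgebra.map_injective_field (LinearMap.ker_eq_bot'.mpr fun ξ h => ?_)
  refine (M0.basis n).ext fun j => ?_
  have hj := DFunLike.congr_fun h (Nat.toPNat (j : ℕ) (Finset.mem_Icc.mp j.2).1)
  rw [LinearMap.sum_apply, Finsupp.finsetSum_apply, Finset.sum_eq_single j] at hj
  · simpa using hj
  · intro q _ hq
    simp only [LinearMap.comp_apply, Finsupp.lsingle_apply]
    refine Finsupp.single_eq_of_ne fun h' => hq (Subtype.ext ?_)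
    exact (congrArg PNat.val h').symm
  · intro h'
    exact absurd (Finset.mem_univ _) h'

/-- The index set of the basis: the integers `i` with `2 + ⌊n/2⌋ ≤ i ≤ n`, and the pairs `(t, k)`
with `4 ≤ t ≤ n` and `2 ≤ k ≤ m`, where `t = 2^p + m`, `0 < m ≤ 2^p`. -/
abbrev Index (n : ℕ) : Type :=
  {i : ℕ // 2 + n / 2 ≤ i ∧ i ≤ n} ⊕
    {tk : ℕ × ℕ // (4 ≤ tk.1 ∧ tk.1 ≤ n) ∧ (2 ≤ tk.2 ∧ tk.2 ≤ mOf tk.1)}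

/-- The form with a given index: `e^{1,i-1,i}`, respectively the `k`-th element of `B_t`. -/
def element (n : ℕ) : Index n → Forms
  | Sum.inl i => ee 1 * ee ((i : ℕ) - 1) * ee (i : ℕ)
  | Sum.inr tk => beta tk.1.1 tk.1.2

end

end MaxClass

namespace MaxClass

noncomputable section

/-! Inside `Forms` the differential is x ↦ e^1 ∧ D x (`incl_ceD`). Write a three-form as e^1 ∧ u + v
with u and v free of e^1. It is a cocycle exactly when D v = 0, and coboundaries change only u, by
elements D z. So H^3 is the sum of the cokernel of D on two-forms in e^2, …, e^n and the kernel of D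
on three-forms in the same variables.

Cokernel: modulo the image of D, e^a ∧ e^b equals e^{a+1} ∧ e^{b-1}, so adjacent pairs span, and
those with small index sum are images. The sum of the coefficients with i + j fixed detects the
others (`two_form_mem_sup`, `two_form_independent`).

Kernel: filter by the largest index t. If x is closed with largest index t, its contraction by e_t
is a closed two-form, determined by its coefficients at e^q ∧ e^{q+1}. The forms `beta t k` are
closed since D F(ω, e^r) = ω ∧ e^r, and their leading coefficients are 1 at q = k and 0 elsewhere
(`coef2_contr_beta`). This is a binomial sum mod 2 (`sum_binom_eq`): for each s it is a sum of two
coefficients of one polynomial (1+X)^{2(k-q)} (1+X+X^2)^{m-k}, and the sum over s telescopes.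

It remains to exclude leading coefficients with k > m. For 2k > t the support forbids them. For m <
k ≤ t/2, D is self-adjoint, up to a boundary term, for the pairing that matches e^i with e^{t+1-i}
(`rev_D`). Pairing x with the beta of level 2^p and index 2^{p-1} + m + 1 - k (t = 2^p + m) leaves
the coefficient in question times a sum equal to 1 (`sum_coef2_contr_two_beta`), so it vanishes
(`leading_coef_eq_zero_of_mOf_lt`). -/

theorem add_self_two {M : Type*} [AddCommGroup M] [Module (ZMod 2) M] (z : M) : z + z = 0 := by
  rw [← two_smul (ZMod 2) z, show (2 : ZMod 2) = 0 from by decide, zero_smul]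

theorem eq_of_add_eq_zero_two {M : Type*} [AddCommGroup M] [Module (ZMod 2) M] {x y : M}
    (h : x + y = 0) : x = y :=
  add_right_cancel (h.trans (add_self_two y).symm)

theorem add_cross_two {M : Type*} [AddCommGroup M] [Module (ZMod 2) M] (a b c d e f : M) :
    (a + b + (c + d)) + (e + c + (b + f)) = (a + e) + (d + f) := by
  have : (a + b + (c + d)) + (e + c + (b + f)) = (a + e) + (d + f) + (b + b) + (c + c) := by abel
  rw [this, add_self_two, add_self_two, add_zero, add_zero]

theorem zmod_two_smul_cases {M : Type*} [AddCommGroup M] [Module (ZMod 2) M] (r : ZMod 2) (x : M) :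
    r • x = 0 ∨ r • x = x := by
  have : r = 0 ∨ r = 1 := by decide +revert
  rcases this with rfl | rfl
  · exact Or.inl (zero_smul _ _)
  · exact Or.inr (one_smul _ _)

/-! ### Contractions and derivations in characteristic two -/

/-- Contraction with the `a`-th vector of the basis dual to `e^1, e^2, …`. -/
def contr (a : ℕ) : Forms →ₗ[ZMod 2] Forms :=
  extDeriv ((Algebra.linearMap (ZMod 2) Forms) ∘ₗ
    (if h : 0 < a then Finsupp.lapply (Nat.toPNat a h) else 0))

theorem contr_mul (a : ℕ) (x y : Forms) : contr a (x * y) = contr a x * y + x * contr a y :=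
  extDeriv_mul _ x y

theorem contr_one (a : ℕ) : contr a 1 = 0 := by
  rw [← map_one (algebraMap (ZMod 2) Forms)]
  exact extDeriv_algebraMap _ 1

theorem ee_zero : ee 0 = 0 := dif_neg (lt_irrefl 0)

theorem contr_ee (a b : ℕ) : contr a (ee b) = if a = b ∧ 0 < a then 1 else 0 := by
  rcases Nat.eq_zero_or_pos b with rfl | hb
  · rw [ee_zero, map_zero, if_neg (by omega)]
  rw [ee, dif_pos hb, contr, extDeriv_ι]
  by_cases ha : 0 < a
  · simp only [dif_pos ha, LinearMap.comp_apply, Finsupp.lapply_apply, Algebra.linearMap_apply,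
      Finsupp.single_apply]
    by_cases hab : a = b
    · subst hab
      simp [ha]
    · rw [if_neg, if_neg (by omega), map_zero]
      exact fun h => hab (congrArg PNat.val h).symm
  · simp [ha]

theorem D_mul (x y : Forms) : D (x * y) = D x * y + x * D y := extDeriv_mul _ x y

theorem D_one : D 1 = 0 := by
  rw [← map_one (algebraMap (ZMod 2) Forms)]
  exact extDeriv_algebraMap _ 1

/-- Linear maps on one-forms are determined by their values at `e^1, e^2, …`. -/
theorem forms_hom_ext {N : Type*} [AddCommGroup N] [Module (ZMod 2) N]
    (f g : Forms →ₗ[ZMod 2] N) (h : ∀ i, 0 < i → f (ee i) = g (ee i))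
    (v : ℕ+ →₀ ZMod 2) : f (ExteriorAlgebra.ι (ZMod 2) v) = g (ExteriorAlgebra.ι (ZMod 2) v) := by
  have : f ∘ₗ ExteriorAlgebra.ι (ZMod 2) = g ∘ₗ ExteriorAlgebra.ι (ZMod 2) := by
    refine Finsupp.lhom_ext' fun i => LinearMap.ext_ring ?_
    have := h i i.pos
    rwa [ee, dif_pos i.pos] at this
  exact LinearMap.congr_fun this v

/-- A derivation kills 1, so generators determine it. In characteristic two squares and commutators
of derivations are again derivations, so the relations between contractions and `D` reduce to a
check on each e^i. -/
theorem forms_derivation_ext (f g : Forms →ₗ[ZMod 2] Forms)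
    (hf : ∀ x y, f (x * y) = f x * y + x * f y) (hg : ∀ x y, g (x * y) = g x * y + x * g y)
    (h : ∀ i, 0 < i → f (ee i) = g (ee i)) : f = g := by
  have key : ∀ f : Forms →ₗ[ZMod 2] Forms, (∀ x y, f (x * y) = f x * y + x * f y) → f 1 = 0 := by
    intro f hf
    have := hf 1 1
    rwa [mul_one, mul_one, one_mul, left_eq_add] at this
  refine LinearMap.ext fun x => ?_
  induction x using ExteriorAlgebra.induction with
  | algebraMap r => rw [Algebra.algebraMap_eq_smul_one, map_smul, map_smul, key f hf, key g hg]
  | add x y hx hy => rw [map_add, map_add, hx, hy]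
  | mul x y hx hy => rw [hf, hg, hx, hy]
  | ι v => exact forms_hom_ext f g h v

theorem contr_contr_self (a : ℕ) (x : Forms) : contr a (contr a x) = 0 := by
  have : contr a ∘ₗ contr a = 0 := by
    refine forms_derivation_ext _ _ (fun x y => ?_) (fun x y => by simp) (fun i _ => ?_)
    · simp only [LinearMap.comp_apply, contr_mul, map_add]
      rw [add_assoc, ← add_assoc (contr a x * contr a y), add_self_two, zero_add]
    · simp only [LinearMap.comp_apply, contr_ee]
      split_ifs <;> simp [contr_one]
  exact LinearMap.congr_fun this x

theorem contr_zero_index (x : Forms) : contr 0 x = 0 := by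
  have : contr 0 = 0 := forms_derivation_ext _ _ (contr_mul 0) (by simp)
    (fun i _ => by rw [contr_ee, if_neg (by omega), LinearMap.zero_apply])
  rw [this, LinearMap.zero_apply]

theorem contr_comm (a b : ℕ) (x : Forms) : contr a (contr b x) = contr b (contr a x) := by
  have : contr a ∘ₗ contr b + contr b ∘ₗ contr a = 0 := by
    refine forms_derivation_ext _ _ (fun x y => ?_) (fun x y => by simp) (fun i _ => ?_)
    · simp only [LinearMap.comp_apply, LinearMap.add_apply, contr_mul, map_add, add_mul, mul_add]
      rw [add_cross_two]
    · simp only [LinearMap.comp_apply, LinearMap.add_apply, contr_ee]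
      split_ifs <;> simp [contr_one]
  exact eq_of_add_eq_zero_two (LinearMap.congr_fun this x)

/-- The commutator sends e^{a+1} to 1, because D e^{a+1} = e^a. For a = 1 this fails, as D e^2 = 0,
and `contr 1` commutes with `D` instead. -/
theorem contr_D (a : ℕ) (ha : 2 ≤ a) (x : Forms) :
    contr a (D x) = D (contr a x) + contr (a + 1) x := by
  have : contr a ∘ₗ D + D ∘ₗ contr a = contr (a + 1) := by
    refine forms_derivation_ext _ _ (fun x y => ?_) (contr_mul _) (fun i _ => ?_)
    · simp only [LinearMap.comp_apply, LinearMap.add_apply, contr_mul, D_mul, map_add, add_mul,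
        mul_add]
      rw [add_cross_two]
    · simp only [LinearMap.comp_apply, LinearMap.add_apply, contr_ee, D_ee]
      rw [apply_ite (contr a), apply_ite D, D_one, map_zero, map_zero, ite_self, add_zero, contr_ee]
      split_ifs <;> first | rfl | omega
  rw [← this, LinearMap.add_apply, add_left_comm]
  simp only [LinearMap.comp_apply, add_self_two, add_zero]

theorem contr_one_D (x : Forms) : contr 1 (D x) = D (contr 1 x) := by
  have : contr 1 ∘ₗ D + D ∘ₗ contr 1 = 0 := by
    refine forms_derivation_ext _ _ (fun x y => ?_) (fun x y => by simp) (fun i _ => ?_)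
    · simp only [LinearMap.comp_apply, LinearMap.add_apply, contr_mul, D_mul, map_add, add_mul,
        mul_add]
      rw [add_cross_two]
    · simp only [LinearMap.comp_apply, LinearMap.add_apply, contr_ee, D_ee]
      rw [apply_ite (contr 1), apply_ite D, D_one, map_zero, map_zero, ite_self, add_zero, contr_ee]
      split_ifs <;> first | rfl | omega
  exact eq_of_add_eq_zero_two (LinearMap.congr_fun this x)

/-- The constant term of a form. -/
abbrev eps : Forms →ₐ[ZMod 2] ZMod 2 := ExteriorAlgebra.algebraMapInv

theorem eps_ee (i : ℕ) : eps (ee i) = 0 := by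
  rw [ee]
  split_ifs
  · simp [eps, ExteriorAlgebra.algebraMapInv]
  · exact map_zero _

theorem eps_D (x : Forms) : eps (D x) = 0 := by
  induction x using ExteriorAlgebra.induction with
  | algebraMap r => rw [D, extDeriv_algebraMap, map_zero]
  | add x y hx hy => rw [map_add, map_add, hx, hy, add_zero]
  | mul x y hx hy => rw [D_mul, map_add, map_mul, map_mul, hx, hy, zero_mul, mul_zero, add_zero]
  | ι v =>
    refine forms_hom_ext (eps.toLinearMap ∘ₗ D) 0 (fun i _ => ?_) v
    change eps (D (ee i)) = 0
    rw [D_ee]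
    split_ifs
    · exact eps_ee _
    · exact map_zero _

/-! ### Forms in finitely many variables and their coefficients -/

/-- The span of `e^1, …, e^n`. -/
def W (n : ℕ) : Submodule (ZMod 2) Forms := Submodule.span (ZMod 2) {x | ∃ i, i ≤ n ∧ ee i = x}

theorem ee_mem_W {i n : ℕ} (h : i ≤ n) : ee i ∈ W n := Submodule.subset_span ⟨i, h, rfl⟩

theorem W_mono {m n : ℕ} (h : m ≤ n) : W m ≤ W n :=
  Submodule.span_mono fun _ ⟨i, hi, hx⟩ => ⟨i, hi.trans h, hx⟩

theorem W_pow_mono {m n : ℕ} (h : m ≤ n) (q : ℕ) : W m ^ q ≤ W n ^ q :=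
  pow_le_pow_left' (W_mono h) q

/-- Scalars are 0 or 1, so closure under addition and the value at 0 suffice. -/
theorem W_pow_induction {n : ℕ} {q : ℕ} {P : Forms → Prop} (h0 : P 0)
    (hadd : ∀ x y, P x → P y → P (x + y))
    (hmul : ∀ i, i ≤ n → ∀ y ∈ W n ^ q, P (ee i * y)) : ∀ x ∈ W n ^ (q + 1), P x := by
  have hP : ∀ r : ZMod 2, ∀ x, P x → P (r • x) := by
    intro r x hx
    rcases zmod_two_smul_cases r x with h | h <;> rw [h]
    exacts [h0, hx]
  intro x hx
  rw [pow_succ'] at hx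
  induction hx using Submodule.mul_induction_on' with
  | mem_mul_mem u hu y hy =>
    induction hu using Submodule.span_induction with
    | mem u hu =>
      obtain ⟨i, hi, rfl⟩ := hu
      exact hmul i hi y hy
    | zero => simpa using h0
    | add u v _ _ hu hv => rw [add_mul]; exact hadd _ _ hu hv
    | smul r u _ hu => rw [smul_mul_assoc]; exact hP _ _ hu
  | add x _ y _ hx hy => exact hadd _ _ hx hy

theorem contr_mem {n q : ℕ} (a : ℕ) : ∀ x ∈ W n ^ (q + 1), contr a x ∈ W n ^ q := by
  induction q with
  | zero =>
    refine W_pow_induction (by simp) (fun x y hx hy => by rw [map_add]; exact add_mem hx hy) ?_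
    intro i _ y hy
    rw [pow_zero, Submodule.mem_one] at hy ⊢
    obtain ⟨r, rfl⟩ := hy
    rw [contr_mul, contr_ee, show contr a (algebraMap _ _ r) = 0 from extDeriv_algebraMap _ r]
    split_ifs
    · exact ⟨r, by simp⟩
    · exact ⟨0, by simp⟩
  | succ q ih =>
    refine W_pow_induction (by simp) (fun x y hx hy => by rw [map_add]; exact add_mem hx hy) ?_
    intro i hi y hy
    rw [contr_mul, contr_ee]
    refine add_mem ?_ ?_
    · split_ifs
      · simpa using hy
      · simp
    · rw [pow_succ']
      exact Submodule.mul_mem_mul (ee_mem_W hi) (ih y hy)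

theorem ee_mul_mem {n q i : ℕ} (hi : i ≤ n) {x : Forms} (hx : x ∈ W n ^ q) :
    ee i * x ∈ W n ^ (q + 1) := by
  rw [pow_succ']
  exact Submodule.mul_mem_mul (ee_mem_W hi) hx

theorem D_mem {n q : ℕ} : ∀ x ∈ W n ^ q, D x ∈ W n ^ q := by
  induction q with
  | zero =>
    intro x hx
    rw [pow_zero, Submodule.mem_one] at hx
    obtain ⟨r, rfl⟩ := hx
    rw [D, extDeriv_algebraMap]
    exact zero_mem _
  | succ q ih =>
    refine W_pow_induction (by simp) (fun x y hx hy => by rw [map_add]; exact add_mem hx hy) ?_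
    intro i hi y hy
    rw [D_mul, D_ee]
    refine add_mem ?_ (ee_mul_mem hi (ih y hy))
    split_ifs
    · exact ee_mul_mem (by omega) hy
    · simp

theorem D_pow_mem {n q : ℕ} (l : ℕ) {x : Forms} (hx : x ∈ W n ^ q) : (D ^ l) x ∈ W n ^ q := by
  induction l with
  | zero => simpa using hx
  | succ l ih => rw [pow_succ', Module.End.mul_apply]; exact D_mem _ ih

theorem contr_eq_zero {n q T : ℕ} (hT : n < T) : ∀ x ∈ W n ^ q, contr T x = 0 := by
  induction q with
  | zero =>
    intro x hx
    rw [pow_zero, Submodule.mem_one] at hx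
    obtain ⟨r, rfl⟩ := hx
    exact extDeriv_algebraMap _ r
  | succ q ih =>
    refine W_pow_induction (by simp) (fun x y hx hy => by rw [map_add, hx, hy, add_zero]) ?_
    intro i hi y hy
    rw [contr_mul, contr_ee, if_neg (by omega), ih y hy, zero_mul, mul_zero, add_zero]

/-- The coefficient of `e^i ∧ e^j`. -/
def coef2 (i j : ℕ) (x : Forms) : ZMod 2 := eps (contr i (contr j x))

theorem coef2_comm (i j : ℕ) (x : Forms) : coef2 i j x = coef2 j i x := by
  rw [coef2, contr_comm, coef2]

theorem coef2_self (i : ℕ) (x : Forms) : coef2 i i x = 0 := by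
  rw [coef2, contr_contr_self, map_zero]

theorem coef2_add (i j : ℕ) (x y : Forms) : coef2 i j (x + y) = coef2 i j x + coef2 i j y := by
  simp only [coef2, map_add]

theorem coef2_sum {ι : Type*} (s : Finset ι) (f : ι → Forms) (i j : ℕ) :
    coef2 i j (∑ a ∈ s, f a) = ∑ a ∈ s, coef2 i j (f a) := by
  simp only [coef2, map_sum]

theorem coef2_smul (i j : ℕ) (r : ZMod 2) (x : Forms) : coef2 i j (r • x) = r * coef2 i j x := by
  simp only [coef2, map_smul, smul_eq_mul]

theorem coef2_D (i j : ℕ) (hi : 2 ≤ i) (hj : 2 ≤ j) (x : Forms) :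
    coef2 i j (D x) = coef2 (i + 1) j x + coef2 i (j + 1) x := by
  simp only [coef2, contr_D _ hi, contr_D _ hj, map_add, eps_D, zero_add]

theorem coef2_ee (i j a b : ℕ) : coef2 i j (ee a * ee b) =
    (if (i = a ∧ j = b) ∧ 0 < i ∧ 0 < j then 1 else 0) +
    (if (i = b ∧ j = a) ∧ 0 < i ∧ 0 < j then 1 else 0) := by
  have h : ∀ (P : Prop) [Decidable P] (y : Forms),
      contr i ((if P then (1 : Forms) else 0) * y) = if P then contr i y else 0 := by
    intro P _ y
    split_ifs <;> simp
  rw [coef2, contr_mul, contr_ee, contr_ee, map_add, h, ext_mul_comm (ee a), h, contr_ee, contr_ee]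
  split_ifs <;> first | omega | simp

theorem two_form_induction {n : ℕ} {P : Forms → Prop} (h0 : P 0)
    (hadd : ∀ x y, P x → P y → P (x + y))
    (hee : ∀ i j, i ≤ n → j ≤ n → P (ee i * ee j)) : ∀ x ∈ W n ^ 2, P x := by
  refine W_pow_induction h0 hadd fun i hi y hy => ?_
  revert y
  refine W_pow_induction (by simpa using h0) (fun x y hx hy => ?_) fun j hj y hy => ?_
  · rw [mul_add]; exact hadd _ _ hx hy
  · rw [pow_zero, Submodule.mem_one] at hy
    obtain ⟨r, rfl⟩ := hy
    rw [← Algebra.commutes, ← Algebra.smul_def, mul_smul_comm]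
    rcases zmod_two_smul_cases r (ee i * ee j) with h | h <;> rw [h]
    exacts [h0, hee i j hi hj]

theorem two_form_expand {n : ℕ} : ∀ x ∈ W n ^ 2,
    x = ∑ p ∈ (Finset.range (n + 1) ×ˢ Finset.range (n + 1)).filter (fun p => p.1 < p.2),
      coef2 p.1 p.2 x • (ee p.1 * ee p.2) := by
  have hsq : ∀ i, ee i * ee i = 0 := by
    intro i
    rw [ee]
    split_ifs
    · exact ExteriorAlgebra.ι_sq_zero _
    · simp
  refine two_form_induction (by simp [coef2]) (fun x y hx hy => ?_) fun i j hi hj => ?_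
  · simp only [coef2_add, add_smul, Finset.sum_add_distrib]
    rw [← hx, ← hy]
  · wlog hij : i ≤ j generalizing i j
    · have := this j i hj hi (by omega)
      rwa [ext_mul_comm]
    rcases Nat.eq_zero_or_pos i with rfl | hi0
    · simp [ee_zero, coef2]
    rcases hij.eq_or_lt with rfl | hij
    · simp [hsq, coef2]
    rw [Finset.sum_eq_single (i, j)]
    · rw [coef2_ee, if_pos (by omega), if_neg (by omega), add_zero, one_smul]
    · rintro ⟨a, b⟩ hab hne
      have hlt : a < b := (Finset.mem_filter.mp hab).2
      have : ¬ (a = i ∧ b = j) := fun h => hne (by rw [h.1, h.2])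
      simp only [coef2_ee]
      rw [if_neg (by omega), if_neg (by omega), add_zero, zero_smul]
    · intro h
      refine absurd ?_ h
      simp only [Finset.mem_filter, Finset.mem_product, Finset.mem_range]
      omega

theorem ee_mul_self (i : ℕ) : ee i * ee i = 0 := by
  rw [ee]
  split_ifs
  · exact ExteriorAlgebra.ι_sq_zero _
  · simp

/-- The Euler operator ∑ e^a ∧ contr a multiplies q-forms by q: it is zero on two-forms and the
identity on three-forms (`three_form_expand`). -/
theorem two_form_euler {n : ℕ} : ∀ x ∈ W n ^ 2,
    ∑ a ∈ Finset.range (n + 1), ee a * contr a x = 0 := by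
  have h : ∀ i, i ≤ n → ∀ y : Forms, ∑ a ∈ Finset.range (n + 1),
      ee a * ((if a = i ∧ 0 < a then 1 else 0) * y) = ee i * y := by
    intro i hi y
    rw [Finset.sum_eq_single i]
    · split_ifs with h
      · rw [one_mul]
      · obtain rfl : i = 0 := by omega
        simp [ee_zero]
    · intro b _ hb
      rw [if_neg (by omega)]; simp
    · intro h
      exact absurd (Finset.mem_range.mpr (by omega)) h
  refine two_form_induction (by simp) (fun x y hx hy => ?_) fun i j hi hj => ?_
  · simp only [map_add, mul_add, Finset.sum_add_distrib, hx, hy, add_zero]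
  · simp only [contr_mul, contr_ee, mul_add, Finset.sum_add_distrib]
    simp only [ext_mul_comm (ee i) (ite _ _ _)]
    rw [h i hi, h j hj, ext_mul_comm (ee j), add_self_two]

theorem three_form_expand {n : ℕ} : ∀ x ∈ W n ^ 3,
    x = ∑ a ∈ Finset.range (n + 1), ee a * contr a x := by
  refine W_pow_induction (by simp) (fun x y hx hy => ?_) fun i hi y hy => ?_
  · simp only [map_add, mul_add, Finset.sum_add_distrib]
    rw [← hx, ← hy]
  · simp only [contr_mul, contr_ee, mul_add, Finset.sum_add_distrib]
    have : ∑ a ∈ Finset.range (n + 1), ee a * (ee i * contr a y) = 0 := by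
      have := two_form_euler y hy
      rw [← mul_zero (ee i), ← this, Finset.mul_sum]
      refine Finset.sum_congr rfl fun a _ => ?_
      rw [← mul_assoc, ← mul_assoc, ext_mul_comm (ee a)]
    rw [this, add_zero, Finset.sum_eq_single i]
    · split_ifs with h
      · rw [one_mul]
      · obtain rfl : i = 0 := by omega
        simp [ee_zero]
    · intro b _ hb
      rw [if_neg (by omega)]; simp
    · intro h
      exact absurd (Finset.mem_range.mpr (by omega)) h

theorem two_form_mem {n t : ℕ} {x : Forms} (hx : x ∈ W n ^ 2)
    (h : ∀ T, t < T → contr T x = 0) : x ∈ W t ^ 2 := by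
  rw [two_form_expand x hx]
  refine Submodule.sum_mem _ fun p hp => ?_
  by_cases h1 : t < p.1
  · rw [coef2_comm, coef2, h _ h1, map_zero, map_zero, zero_smul]; exact zero_mem _
  by_cases h2 : t < p.2
  · rw [coef2, h _ h2, map_zero, map_zero, zero_smul]; exact zero_mem _
  refine Submodule.smul_mem _ _ (ee_mul_mem (by omega) ?_)
  rw [pow_one]
  exact ee_mem_W (by omega)

theorem three_form_mem {n t : ℕ} {x : Forms} (hx : x ∈ W n ^ 3)
    (h : ∀ T, t < T → contr T x = 0) : x ∈ W t ^ 3 := by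
  rw [three_form_expand x hx]
  refine Submodule.sum_mem _ fun a ha => ?_
  by_cases h1 : t < a
  · rw [h _ h1, mul_zero]; exact zero_mem _
  refine ee_mul_mem (by omega) (two_form_mem (contr_mem a x hx) fun T hT => ?_)
  rw [contr_comm, h T hT, map_zero]

theorem two_form_eq_zero {n : ℕ} {x : Forms} (hx : x ∈ W n ^ 2)
    (h : ∀ i j, i < j → coef2 i j x = 0) : x = 0 := by
  rw [two_form_expand x hx]
  refine Finset.sum_eq_zero fun p hp => ?_
  rw [h _ _ (Finset.mem_filter.mp hp).2, zero_smul]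

/-! ### Binomial sums modulo two via polynomials -/

section Binomial

open Polynomial

theorem one_add_X_pow_two_pow (s : ℕ) : ((1 + X : (ZMod 2)[X])) ^ 2 ^ s = 1 + X ^ 2 ^ s := by
  have : Fact (Nat.Prime 2) := ⟨Nat.prime_two⟩
  rw [add_pow_char_pow, one_pow]

theorem coeff_one_add_X_pow_two (n k : ℕ) :
    ((1 + X : (ZMod 2)[X]) ^ n).coeff k = (n.choose k : ZMod 2) := coeff_one_add_X_pow _ n k

theorem coeff_one_add_X_pow_mul (N n : ℕ) (P : (ZMod 2)[X]) :
    ((1 + X ^ N) * P).coeff n = P.coeff n + if N ≤ n then P.coeff (n - N) else 0 := by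
  rw [add_mul, one_mul, coeff_add, coeff_X_pow_mul']

/-- A binomial coefficient whose parity is read off the top binary digits. -/
theorem choose_eq_zero_of_digits (q c u y : ℕ) (h : c + y + u < 2 ^ q) :
    (((2 * 2 ^ q + c + 2 * u).choose (2 ^ q + y + u) : ℕ) : ZMod 2) = 0 := by
  rw [← coeff_one_add_X_pow_two]
  -- If c + 2u < 2^q, the lower index exceeds c + 2u and is below 2^(q+1), so neither part of (1 +
  -- X^(2^(q+1))) (1 + X)^(c+2u) reaches it.
  rcases lt_or_ge (c + 2 * u) (2 ^ q) with hA | hA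
  · rw [show 2 * 2 ^ q + c + 2 * u = 2 ^ (q + 1) + (c + 2 * u) by rw [pow_succ]; ring, pow_add,
      one_add_X_pow_two_pow, coeff_one_add_X_pow_mul, coeff_one_add_X_pow_two,
      Nat.choose_eq_zero_of_lt (by omega), if_neg (by rw [pow_succ]; omega)]
    simp
  -- Here a second factor 1 + X^(2^q) splits off; the remaining exponent d is less than y + u.
  · obtain ⟨d, hd⟩ := Nat.exists_eq_add_of_le hA
    rw [show 2 * 2 ^ q + c + 2 * u = 2 ^ (q + 1) + (2 ^ q + d) by rw [pow_succ]; omega,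
      pow_add (1 + X), pow_add (1 + X), one_add_X_pow_two_pow, one_add_X_pow_two_pow, coeff_one_add_X_pow_mul,
      coeff_one_add_X_pow_mul, if_pos (by omega), if_neg (by rw [pow_succ]; omega),
      coeff_one_add_X_pow_two, coeff_one_add_X_pow_two, Nat.choose_eq_zero_of_lt (by omega),
      Nat.choose_eq_zero_of_lt (by omega)]
    simp

theorem binom_cast (N j : ℕ) : binom N (j : ℤ) = N.choose j := by
  rw [binom, if_pos (by positivity), Int.toNat_natCast]

theorem binom_of_neg {N : ℕ} {z : ℤ} (h : z < 0) : binom N z = 0 := if_neg (by omega)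

theorem binom_of_gt {N : ℕ} {z : ℤ} (h : (N : ℤ) < z) : binom N z = 0 := by
  obtain ⟨j, rfl⟩ := Int.eq_ofNat_of_zero_le (show 0 ≤ z by omega)
  rw [binom_cast]
  exact Nat.choose_eq_zero_of_lt (by exact_mod_cast h)

theorem binom_succ (N : ℕ) (z : ℤ) : binom (N + 1) z = binom N z + binom N (z - 1) := by
  rcases lt_trichotomy z 0 with h | rfl | h
  · rw [binom_of_neg h, binom_of_neg h, binom_of_neg (by omega)]
  · rw [binom_of_neg (show (0 : ℤ) - 1 < 0 by omega)]
    simp [binom]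
  · obtain ⟨j, rfl⟩ := Int.eq_ofNat_of_zero_le h.le
    obtain ⟨i, rfl⟩ : ∃ i, j = i + 1 := ⟨j - 1, by omega⟩
    rw [binom_cast, binom_cast, show ((i + 1 : ℕ) : ℤ) - 1 = (i : ℕ) by push_cast; ring, binom_cast,
      Nat.choose_succ_succ', add_comm]

theorem binom_symm (N : ℕ) (z : ℤ) : binom N (N - z) = binom N z := by
  rcases lt_or_ge z 0 with h | h
  · rw [binom_of_neg h, binom_of_gt (by omega)]
  rcases lt_or_ge (N : ℤ) z with h' | h'
  · rw [binom_of_gt h', binom_of_neg (by omega)]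
  obtain ⟨j, rfl⟩ := Int.eq_ofNat_of_zero_le h
  have hj : j ≤ N := by exact_mod_cast h'
  rw [← Nat.cast_sub hj, binom_cast, binom_cast, Nat.choose_symm hj]

/-- The summands below the summation range of `beta` do not contribute. -/
theorem binom_mul_choose_eq_zero {p m k q r s : ℕ} (hm : m ≤ 2 ^ p) (hk : k ≤ m)
    (h1 : 1 ≤ q) (hqk : q ≤ k) (hr : 3 * r < 2 ^ p + m + 2 * k + 1) (hs : s < p) :
    (binom (m - k) (((2 ^ p + m : ℕ) : ℤ) - r - 2 ^ s) : ZMod 2) *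
      ((2 ^ p + m + 2 * (k - q) - r).choose (r - q) : ZMod 2) = 0 := by
  rcases lt_or_ge (((m - k : ℕ)) : ℤ) (((2 ^ p + m : ℕ) : ℤ) - r - 2 ^ s) with h | h
  · rw [binom_of_gt h, Nat.cast_zero, zero_mul]
  have hge : 2 ^ p + k ≤ r + 2 ^ s := by
    have h' : ((2 ^ p + m : ℕ) : ℤ) - r - ((2 ^ s : ℕ) : ℤ) ≤ ((m - k : ℕ) : ℤ) := by
      push_cast at h ⊢; exact h
    omega
  obtain ⟨e, rfl⟩ : ∃ e, p = e + 1 := ⟨p - 1, by omega⟩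
  -- A nonzero first factor gives r ≥ 2^p + k - 2^s. For s ≤ p - 2 this contradicts the upper bound
  -- on 3r, so only the top value s = p - 1 is left.
  have hse : s = e := by
    by_contra hne
    have : 2 ^ (s + 1) ≤ 2 ^ e := Nat.pow_le_pow_right (by norm_num) (by omega)
    rw [pow_succ] at this hge hm hr
    omega
  subst hse
  rw [pow_succ] at hge hm hr
  have hrm : r ≤ m := by omega
  have hc := choose_eq_zero_of_digits s (m - r) (k - q) (r - k - 2 ^ s) (by omega)
  rw [show 2 ^ (s + 1) + m + 2 * (k - q) - r = 2 * 2 ^ s + (m - r) + 2 * (k - q) by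
      rw [pow_succ]; omega,
    show r - q = 2 ^ s + (r - k - 2 ^ s) + (k - q) by omega, hc, mul_zero]

theorem trinomial_expand (M : ℕ) : ((1 + X * (1 + X) : (ZMod 2)[X])) ^ M =
    ∑ j ∈ Finset.range (M + 1), (M.choose j : (ZMod 2)[X]) * (X ^ j * (1 + X) ^ j) := by
  rw [add_comm, add_pow]
  refine Finset.sum_congr rfl fun j _ => ?_
  rw [one_pow, mul_one, mul_pow, mul_comm]

/-- The sides differ by 2X. The right side makes central binomial coefficients appear in
`coeff_central`. -/
theorem trinomial_eq : (1 + X * (1 + X) : (ZMod 2)[X]) = X + (1 + X) ^ 2 := by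
  have h2 : (2 : (ZMod 2)[X]) = 0 := by
    rw [← C_ofNat, show (OfNat.ofNat 2 : ZMod 2) = 0 from by decide, C_0]
  linear_combination (-X) * h2

/-- For a fixed power of two, the complete sum is a coefficient of a product of a power of `1 + X`
and a power of `1 + X + X ^ 2`. -/
theorem sum_binom_mul_choose {t M q N R : ℕ} (hqR : q ≤ R) (hRt : R ≤ t) :
    ∑ r ∈ Finset.Icc q t, (binom M ((R : ℤ) - r) : ZMod 2) * ((N + R - r).choose (r - q) : ZMod 2) =
      ((1 + X) ^ N * (1 + X * (1 + X)) ^ M : (ZMod 2)[X]).coeff (R - q) := by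
  have hl : ∑ r ∈ Finset.Icc q t, (binom M ((R : ℤ) - r) : ZMod 2) *
      ((N + R - r).choose (r - q) : ZMod 2) =
      ∑ j ∈ Finset.range (R - q + 1), (M.choose j : ZMod 2) * ((N + j).choose (R - q - j) : ZMod 2) := by
    rw [← Finset.sum_subset (Finset.Icc_subset_Icc_right hRt)]
    · refine Finset.sum_nbij' (fun r => R - r) (fun j => R - j) ?_ ?_ ?_ ?_ ?_
      · intro r hr
        have := Finset.mem_Icc.mp hr
        exact Finset.mem_range.mpr (by omega)
      · intro j hj
        have := Finset.mem_range.mp hj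
        exact Finset.mem_Icc.mpr (by omega)
      · intro r hr
        have := Finset.mem_Icc.mp hr
        change R - (R - r) = r
        omega
      · intro j hj
        have := Finset.mem_range.mp hj
        change R - (R - j) = j
        omega
      · intro r hr
        have := Finset.mem_Icc.mp hr
        rw [← Nat.cast_sub this.2, binom_cast, show N + R - r = N + (R - r) by omega,
          show R - q - (R - r) = r - q by omega]
    · intro r hr hr'
      have h1 := Finset.mem_Icc.mp hr
      have h2 : ¬ (q ≤ r ∧ r ≤ R) := fun h => hr' (Finset.mem_Icc.mpr h)
      rw [binom_of_neg (by omega), Nat.cast_zero, zero_mul]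
  rw [hl, trinomial_expand, Finset.mul_sum, finsetSum_coeff]
  have hterm : ∀ j, ((1 + X) ^ N * ((M.choose j : (ZMod 2)[X]) * (X ^ j * (1 + X) ^ j))).coeff (R - q) =
      if j ≤ R - q then (M.choose j : ZMod 2) * ((N + j).choose (R - q - j) : ZMod 2) else 0 := by
    intro j
    rw [show (1 + X) ^ N * ((M.choose j : (ZMod 2)[X]) * (X ^ j * (1 + X) ^ j)) =
      (M.choose j : (ZMod 2)[X]) * (X ^ j * (1 + X) ^ (N + j)) by rw [pow_add]; ring,
      coeff_natCast_mul, coeff_X_pow_mul', coeff_one_add_X_pow_two]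
    split_ifs <;> simp
  simp only [hterm]
  rw [← Finset.sum_filter]
  have h1 : (Finset.range (M + 1)).filter (fun j => j ≤ R - q) ⊆ Finset.range (R - q + 1) := by
    intro j hj
    have := (Finset.mem_filter.mp hj).2
    exact Finset.mem_range.mpr (by omega)
  refine (Finset.sum_subset h1 fun j hj hj' => ?_).symm
  have h2 := Finset.mem_range.mp hj
  have h3 : ¬ (j < M + 1 ∧ j ≤ R - q) := fun h =>
    hj' (Finset.mem_filter.mpr ⟨Finset.mem_range.mpr h.1, h.2⟩)
  rw [Nat.choose_eq_zero_of_lt (by omega), Nat.cast_zero, zero_mul]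

/-- The central coefficient. -/
theorem coeff_central (a M : ℕ) :
    ((1 + X) ^ (2 * a) * (1 + X * (1 + X)) ^ M : (ZMod 2)[X]).coeff (a + M) =
      if a = 0 then 1 else 0 := by
  -- The j-th term contributes a multiple of the central binomial coefficient of a + j, which is
  -- even unless a + j = 0.
  have hterm : ∀ j, j ≤ M →
      ((1 + X) ^ (2 * a) * (((1 + X) ^ 2) ^ j * X ^ (M - j) * (M.choose j : (ZMod 2)[X]))).coeff
        (a + M) = if a + j = 0 then 1 else 0 := by
    intro j hj
    rw [show (1 + X) ^ (2 * a) * (((1 + X) ^ 2) ^ j * X ^ (M - j) * (M.choose j : (ZMod 2)[X])) =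
      (M.choose j : (ZMod 2)[X]) * (X ^ (M - j) * (1 + X) ^ (2 * (a + j))) by
        rw [← pow_mul, mul_add, pow_add]; ring,
      coeff_natCast_mul, coeff_X_pow_mul', if_pos (by omega), show a + M - (M - j) = a + j by omega,
      coeff_one_add_X_pow_two]
    split_ifs with h
    · obtain ⟨rfl, rfl⟩ : a = 0 ∧ j = 0 := by omega
      simp
    · have := Nat.two_dvd_centralBinom_of_one_le (n := a + j) (by omega)
      rw [Nat.centralBinom_eq_two_mul_choose] at this
      rw [(ZMod.natCast_eq_zero_iff _ 2).mpr this, mul_zero]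
  rw [trinomial_eq, add_comm X, add_pow ((1 + X) ^ 2), Finset.mul_sum, finsetSum_coeff,
    Finset.sum_congr rfl (fun j hj => hterm j (by have := Finset.mem_range.mp hj; omega))]
  split_ifs with h
  · subst h
    simp
  · exact Finset.sum_eq_zero fun j _ => if_neg (by omega)

theorem natDegree_trinomial_le (a M : ℕ) :
    ((1 + X) ^ (2 * a) * (1 + X * (1 + X)) ^ M : (ZMod 2)[X]).natDegree ≤ 2 * (a + M) := by
  compute_degree
  omega

theorem coeff_top (a M : ℕ) :
    ((1 + X) ^ (2 * a) * (1 + X * (1 + X)) ^ M : (ZMod 2)[X]).coeff (2 * (a + M)) = 1 := by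
  have h1 : ((1 + X : (ZMod 2)[X]) ^ (2 * a)).natDegree ≤ 2 * a := by compute_degree
  have h2 : ((1 + X * (1 + X) : (ZMod 2)[X])).natDegree ≤ 2 := by compute_degree
  have h3 : ((1 + X * (1 + X) : (ZMod 2)[X]) ^ M).natDegree ≤ M * 2 := natDegree_pow_le_of_le M h2
  rw [show 2 * (a + M) = 2 * a + M * 2 by ring, coeff_mul_add_eq_of_natDegree_le h1 h3,
    coeff_pow_of_natDegree_le h2, coeff_one_add_X_pow_two, Nat.choose_self]
  rw [show (1 + X * (1 + X) : (ZMod 2)[X]) = 1 + X + X ^ 2 by ring]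
  simp [coeff_one, coeff_X]

/-- The evaluation of the binomial sum which governs the leading terms of `beta`. -/
theorem sum_binom_eq {t p m k q a : ℕ} (ht : t = 2 ^ p + m) (hm : m ≤ 2 ^ p) (hk2 : 2 ≤ k) (hk : k ≤ m)
    (h1 : 1 ≤ q) (hqk : q ≤ k) (hq : 2 ≤ q ∨ m = 2 ^ p)
    (ha : ∀ r, a ≤ r ↔ t + 2 * k + 1 ≤ 3 * r) :
    ∑ r ∈ Finset.Icc a (t / 2 + k - 1),
      (∑ s ∈ Finset.range p, (binom (m - k) ((t : ℤ) - r - 2 ^ s) : ZMod 2)) *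
        ((t + 2 * (k - q) - r).choose (r - q) : ZMod 2) =
      (if q = k then 1 else 0) + (if q = 1 then 1 else 0) := by
  have hp : 1 ≤ p := by
    by_contra h
    obtain rfl : p = 0 := by omega
    simp at hm
    omega
  -- For q = 1 one has t = 2^(p+1), and its evenness is needed for the binomial coefficients to
  -- vanish above the upper summation bound.
  have hpe : Even (2 ^ p) := (Nat.even_pow.mpr ⟨even_two, by omega⟩)
  rw [even_iff_two_dvd] at hpe
  have hfull : ∑ r ∈ Finset.Icc a (t / 2 + k - 1),
      (∑ s ∈ Finset.range p, (binom (m - k) ((t : ℤ) - r - 2 ^ s) : ZMod 2)) *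
        ((t + 2 * (k - q) - r).choose (r - q) : ZMod 2) =
      ∑ r ∈ Finset.Icc q t,
      (∑ s ∈ Finset.range p, (binom (m - k) ((t : ℤ) - r - 2 ^ s) : ZMod 2)) *
        ((t + 2 * (k - q) - r).choose (r - q) : ZMod 2) := by
    refine Finset.sum_subset ?_ ?_
    · intro r hr
      have h := Finset.mem_Icc.mp hr
      have h' := (ha r).mp h.1
      exact Finset.mem_Icc.mpr (by omega)
    · intro r hr hr'
      have h := Finset.mem_Icc.mp hr
      by_cases har : a ≤ r
      · have hb : ¬ r ≤ t / 2 + k - 1 := fun h' => hr' (Finset.mem_Icc.mpr ⟨har, h'⟩)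
        rw [Nat.choose_eq_zero_of_lt (by omega), Nat.cast_zero, mul_zero]
      · rw [ha] at har
        rw [Finset.sum_mul]
        refine Finset.sum_eq_zero fun s hs => ?_
        have := binom_mul_choose_eq_zero hm hk h1 hqk (r := r) (by omega) (Finset.mem_range.mp hs)
        rwa [← ht] at this
  rw [hfull]
  simp only [Finset.sum_mul]
  rw [Finset.sum_comm]
  -- For fixed s the sum is the coefficient of (1+X)^(2^s) H = (1 + X^(2^s)) H in degree t - q -
  -- 2^s. Its two contributions are coefficients of H in degrees t - q - 2^s and t - q - 2^(s+1), so
  -- the sum over s telescopes.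
  set H : (ZMod 2)[X] := (1 + X) ^ (2 * (k - q)) * (1 + X * (1 + X)) ^ (m - k) with hH
  have hs : ∀ s ∈ Finset.range p, ∑ r ∈ Finset.Icc q t,
      (binom (m - k) ((t : ℤ) - r - 2 ^ s) : ZMod 2) *
        ((t + 2 * (k - q) - r).choose (r - q) : ZMod 2) =
      H.coeff (t - q - 2 ^ s) - H.coeff (t - q - 2 ^ (s + 1)) := by
    intro s hs
    have hsp : 2 ^ (s + 1) ≤ 2 ^ p :=
      Nat.pow_le_pow_right (by norm_num) (Finset.mem_range.mp hs)
    rw [pow_succ] at hsp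
    have hcoef := sum_binom_mul_choose (t := t) (M := m - k) (q := q) (N := 2 * (k - q) + 2 ^ s)
      (R := t - 2 ^ s) (by omega) (by omega)
    rw [pow_add, one_add_X_pow_two_pow, mul_comm _ (1 + X ^ 2 ^ s), mul_assoc,
      coeff_one_add_X_pow_mul, if_pos (by omega), ← hH] at hcoef
    rw [CharTwo.sub_eq_add, show t - q - 2 ^ s = t - 2 ^ s - q by omega,
      show t - q - 2 ^ (s + 1) = t - 2 ^ s - q - 2 ^ s by rw [pow_succ]; omega, ← hcoef]
    refine Finset.sum_congr rfl fun r hr => ?_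
    rw [show 2 * (k - q) + 2 ^ s + (t - 2 ^ s) - r = t + 2 * (k - q) - r by omega,
      show (((t - 2 ^ s : ℕ) : ℤ) - r) = (t : ℤ) - r - 2 ^ s by
        rw [Nat.cast_sub (by omega)]; push_cast; ring]
  rw [Finset.sum_congr rfl hs, Finset.sum_range_sub', CharTwo.sub_eq_add, pow_zero, add_comm]
  congr 1
  -- Degree t - q - 2^p is the middle of H. Degree t - q - 1 is beyond the degree of H, except for q
  -- = 1 and m = 2^p, when it is the top degree.
  · rw [show t - q - 2 ^ p = (k - q) + (m - k) by omega, hH, coeff_central]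
    simp only [show k - q = 0 ↔ q = k by omega]
  · split_ifs with h
    · obtain hmp := hq.resolve_left (by omega)
      rw [show t - q - 1 = 2 * ((k - q) + (m - k)) by omega, hH, coeff_top]
    · refine coeff_eq_zero_of_natDegree_lt (lt_of_le_of_lt (natDegree_trinomial_le _ _) ?_)
      omega

end Binomial

/-! ### Powers of D on two-forms and the operation F -/

/-- Each application of `D` lowers one index by one; the binomials count which of the l steps hit
the factor that ends at i. -/
theorem coef2_D_pow (x r : ℕ) (l : ℕ) : ∀ i j : ℕ, 2 ≤ i → 2 ≤ j →
    coef2 i j ((D ^ l) (ee x * ee r)) =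
      if i + j + l = x + r then
        (binom l ((x : ℤ) - i) : ZMod 2) + (binom l ((r : ℤ) - i) : ZMod 2) else 0 := by
  induction l with
  | zero =>
    intro i j hi hj
    have h0 : ∀ z : ℤ, binom 0 z = if z = 0 then 1 else 0 := by
      intro z
      rcases lt_trichotomy z 0 with h | h | h
      · rw [binom_of_neg h, if_neg h.ne]
      · subst h; rfl
      · rw [binom_of_gt (by simpa using h), if_neg h.ne']
    rw [pow_zero, Module.End.one_apply, coef2_ee, h0, h0]
    simp only [Nat.cast_ite, Nat.cast_one, Nat.cast_zero, sub_eq_zero, Nat.cast_inj]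
    split_ifs <;> first | rfl | omega
  | succ l ih =>
    intro i j hi hj
    rw [pow_succ', Module.End.mul_apply, coef2_D i j hi hj, ih (i + 1) j (by omega) hj,
      ih i (j + 1) hi (by omega), binom_succ, binom_succ]
    simp only [show i + 1 + j + l = i + j + (l + 1) by ring,
      show i + (j + 1) + l = i + j + (l + 1) by ring]
    split_ifs
    · push_cast
      rw [sub_sub, sub_sub]
      ring
    · rw [add_zero]

theorem contr_one_D_pow (l : ℕ) {ω : Forms} (h : contr 1 ω = 0) : contr 1 ((D ^ l) ω) = 0 := by
  induction l with
  | zero => simpa using h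
  | succ l ih => rw [pow_succ', Module.End.mul_apply, contr_one_D, ih, map_zero]

theorem F_eq_sum (ω : Forms) (i : ℕ) : ∃ N₀ : ℕ, ∀ N, N₀ ≤ N → (D ^ N) ω = 0 ∧
    F ω i = ∑ l ∈ Finset.range N, (D ^ l) ω * ee (i + l + 1) := by
  obtain ⟨N₀, h⟩ := D_nilpotent ω
  have hz : ∀ N, N₀ ≤ N → (D ^ N) ω = 0 := by
    intro N hN
    obtain ⟨c, rfl⟩ := Nat.exists_eq_add_of_le hN
    rw [add_comm N₀ c, pow_add, Module.End.mul_apply, h, map_zero]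
  refine ⟨N₀, fun N hN => ⟨hz N hN, ?_⟩⟩
  refine finsum_eq_sum_of_support_subset _ fun l hl => ?_
  by_contra h'
  rw [Finset.coe_range, Set.mem_Iio, not_lt] at h'
  exact hl (by
    change (D ^ l) ω * _ = 0
    rw [hz l (by omega), zero_mul])

/-- `F` is a right inverse of `D`. -/
theorem D_F (ω : Forms) (i : ℕ) (hi : 2 ≤ i) : D (F ω i) = ω * ee i := by
  obtain ⟨N, hN⟩ := F_eq_sum ω i
  obtain ⟨h0, hF⟩ := hN N le_rfl
  -- By Leibniz each summand becomes a difference of consecutive terms; i ≥ 2 ensures D e^{i+l+1} =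
  -- e^{i+l}.
  have hs : ∀ l ∈ Finset.range N, D ((D ^ l) ω * ee (i + l + 1)) =
      (D ^ l) ω * ee (i + l) - (D ^ (l + 1)) ω * ee (i + (l + 1)) := by
    intro l _
    rw [D_mul, D_ee, if_pos (by omega), pow_succ', Module.End.mul_apply, sub_eq_add_neg,
      ← eq_neg_of_add_eq_zero_left (add_self_two _), add_comm]
    rfl
  rw [hF, map_sum, Finset.sum_congr rfl hs,
    Finset.sum_range_sub' (fun l => (D ^ l) ω * ee (i + l)), h0, zero_mul, sub_zero]
  simp

theorem F_mem {n : ℕ} (ω : Forms) (hω : ω ∈ W n ^ 2) (i : ℕ) : ∃ N, F ω i ∈ W N ^ 3 := by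
  obtain ⟨N, hN⟩ := F_eq_sum ω i
  rw [(hN N le_rfl).2]
  refine ⟨n + i + N + 1, Submodule.sum_mem _ fun l hl => ?_⟩
  have := Finset.mem_range.mp hl
  rw [ext_mul_comm]
  exact ee_mul_mem (by omega) (W_pow_mono (by omega) 2 (D_pow_mem l hω))

theorem contr_one_F {ω : Forms} (h : contr 1 ω = 0) (i : ℕ) (hi : 1 ≤ i) :
    contr 1 (F ω i) = 0 := by
  obtain ⟨N, hN⟩ := F_eq_sum ω i
  rw [(hN N le_rfl).2, map_sum]
  refine Finset.sum_eq_zero fun l _ => ?_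
  rw [contr_mul, contr_one_D_pow l h, contr_ee, if_neg (by omega), zero_mul, mul_zero, add_zero]

/-- D^l ω involves only indices up to r, so e^T occurs in a single summand of F. -/
theorem contr_F {r T : ℕ} {ω : Forms} (hω : ω ∈ W r ^ 2) (hT : r < T) :
    contr T (F ω r) = (D ^ (T - r - 1)) ω := by
  obtain ⟨N, hN⟩ := F_eq_sum ω r
  rw [(hN (N + T) (by omega)).2, map_sum, Finset.sum_eq_single (T - r - 1)]
  · rw [contr_mul, contr_eq_zero hT _ (D_pow_mem _ hω), contr_ee, if_pos (by omega), zero_mul,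
      mul_one, zero_add]
  · intro l _ hl
    rw [contr_mul, contr_eq_zero hT _ (D_pow_mem _ hω), contr_ee, if_neg (by omega), zero_mul,
      mul_zero, zero_add]
  · intro h
    exact absurd (Finset.mem_range.mpr (by omega)) h

theorem coef2_contr_F_of_le {r a b c : ℕ} (ω : Forms) (ha : a ≤ r) (hb : b ≤ r)
    (hc : c ≤ r) : coef2 a b (contr c (F ω r)) = 0 := by
  obtain ⟨N, hN⟩ := F_eq_sum ω r
  rw [(hN N le_rfl).2, map_sum, coef2_sum]
  refine Finset.sum_eq_zero fun l _ => ?_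
  have h : ∀ i ≤ r, ∀ x : Forms, contr i (x * ee (r + l + 1)) = contr i x * ee (r + l + 1) := by
    intro i hi x
    rw [contr_mul, contr_ee, if_neg (by omega), mul_zero, add_zero]
  rw [coef2, h c hc, h b hb, h a ha, map_mul, eps_ee, mul_zero]

theorem ee_mul_ee_mem {i j n : ℕ} (hi : i ≤ n) (hj : j ≤ n) : ee i * ee j ∈ W n ^ 2 :=
  ee_mul_mem hi (by rw [pow_one]; exact ee_mem_W hj)

theorem contr_one_ee_mul_ee {i j : ℕ} (hi : 2 ≤ i) (hj : 2 ≤ j) : contr 1 (ee i * ee j) = 0 := by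
  rw [contr_mul, contr_ee, contr_ee, if_neg (by omega), if_neg (by omega), zero_mul, mul_zero,
    add_zero]

/-- The lower bound of the summation in the definition of `beta`, without rounding. -/
theorem ceil_le_iff (t k r : ℕ) :
    ⌈((t + 2 * k + 1 : ℕ) : ℚ) / 3⌉₊ ≤ r ↔ t + 2 * k + 1 ≤ 3 * r := by
  rw [Nat.ceil_le, div_le_iff₀ (by norm_num), mul_comm (r : ℚ)]
  exact_mod_cast Iff.rfl

/-! ### The forms beta and their leading coefficients -/

section Beta

variable {t k : ℕ}

theorem decomp (ht : 2 ≤ t) : t = 2 ^ pOf t + mOf t ∧ 0 < mOf t ∧ mOf t ≤ 2 ^ pOf t :=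
  (pOf_mOf_iff t ht _ _).mpr ⟨rfl, rfl⟩

theorem beta_range (ht : 4 ≤ t) (hk : k ≤ mOf t) {r : ℕ}
    (hr : r ∈ Finset.Icc ⌈((t + 2 * k + 1 : ℕ) : ℚ) / 3⌉₊ (t / 2 + k - 1)) :
    t + 2 * k + 1 ≤ 3 * r ∧ 2 * r + 2 ≤ t + 2 * k ∧ r < t := by
  rw [Finset.mem_Icc, ceil_le_iff] at hr
  have := decomp (t := t) (by omega)
  omega

/-- The scalar coefficients in the definition of `beta`. -/
def betaScalar (t k r : ℕ) : ZMod 2 :=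
  ∑ s ∈ Finset.range (pOf t), (binom (mOf t - k) ((t : ℤ) - r - 2 ^ s) : ZMod 2)

theorem beta_eq (t k : ℕ) : beta t k =
    ∑ r ∈ Finset.Icc ⌈((t + 2 * k + 1 : ℕ) : ℚ) / 3⌉₊ (t / 2 + k - 1),
      betaScalar t k r • F (ee (t + 2 * k - 2 * r) * ee r) r := by
  rw [beta]
  refine Finset.sum_congr rfl fun r _ => ?_
  rw [betaScalar, Finset.sum_smul]

/-- Each summand is sent to e^x ∧ e^r ∧ e^r = 0. -/
theorem D_beta (ht : 4 ≤ t) (hk : k ≤ mOf t) : D (beta t k) = 0 := by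
  rw [beta_eq, map_sum]
  refine Finset.sum_eq_zero fun r hr => ?_
  have := beta_range ht hk hr
  rw [map_smul, D_F _ _ (by omega), mul_assoc, ee_mul_self, mul_zero, smul_zero]

theorem contr_one_beta (ht : 4 ≤ t) (hk : k ≤ mOf t) : contr 1 (beta t k) = 0 := by
  rw [beta_eq, map_sum]
  refine Finset.sum_eq_zero fun r hr => ?_
  have := beta_range ht hk hr
  rw [map_smul, contr_one_F (contr_one_ee_mul_ee (by omega) (by omega)) _ (by omega), smul_zero]

theorem beta_mem_aux (t k : ℕ) : ∃ N, beta t k ∈ W N ^ 3 := by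
  have : ∀ r : ℕ, ∃ N, F (ee (t + 2 * k - 2 * r) * ee r) r ∈ W N ^ 3 := fun r =>
    F_mem (n := t + 2 * k + r) _ (ee_mul_ee_mem (by omega) (by omega)) r
  choose N hN using this
  refine ⟨∑ r ∈ Finset.Icc ⌈((t + 2 * k + 1 : ℕ) : ℚ) / 3⌉₊ (t / 2 + k - 1), N r, ?_⟩
  rw [beta_eq]
  refine Submodule.sum_mem _ fun r hr => Submodule.smul_mem _ _ ?_
  exact W_pow_mono (Finset.single_le_sum (f := N) (fun _ _ => Nat.zero_le _) hr) 3 (hN r)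

theorem coef2_contr_F {i j T x r : ℕ} (hi : 2 ≤ i) (hj : 2 ≤ j) (hx : x ≤ r) (hT : r < T) :
    coef2 i j (contr T (F (ee x * ee r) r)) = if i + j + T = x + 2 * r + 1 then
      (binom (T - r - 1) ((x : ℤ) - i) : ZMod 2) + (binom (T - r - 1) ((r : ℤ) - i) : ZMod 2)
      else 0 := by
  rw [contr_F (ee_mul_ee_mem hx le_rfl) hT, coef2_D_pow _ _ _ _ _ hi hj]
  simp only [show i + j + (T - r - 1) = x + r ↔ i + j + T = x + 2 * r + 1 by omega]

/-- Give e^i weight i. In F, the factor e^{r+l+1} compensates the weight lost through D^l, so every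
summand of beta has weight t + 2k + 1. -/
theorem coef2_contr_beta_weight (ht : 4 ≤ t) (hk : k ≤ mOf t) {i j T : ℕ} (hi : 2 ≤ i)
    (hj : 2 ≤ j) (hT : 2 ≤ T) (h : i + j + T ≠ t + 2 * k + 1) :
    coef2 i j (contr T (beta t k)) = 0 := by
  rw [beta_eq, map_sum, coef2_sum]
  refine Finset.sum_eq_zero fun r hr => ?_
  have hr' := beta_range ht hk hr
  rw [map_smul, coef2_smul]
  -- Contractions commute, so the largest index may be contracted first. If it is above r, `contr_F`
  -- applies; otherwise no term of F contributes.
  suffices hmax : ∀ a b c : ℕ, 2 ≤ a → 2 ≤ b → 2 ≤ c → a + b + c ≠ t + 2 * k + 1 →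
      a ≤ c → b ≤ c → coef2 a b (contr c (F (ee (t + 2 * k - 2 * r) * ee r) r)) = 0 by
    have hperm1 : ∀ (a b c : ℕ) (z : Forms), coef2 a b (contr c z) = coef2 a c (contr b z) := by
      intro a b c z
      rw [coef2, contr_comm b c, coef2]
    rcases le_total i T with h1 | h1
    · rcases le_total j T with h2 | h2
      · rw [hmax i j T hi hj hT h h1 h2, mul_zero]
      · rw [hperm1, hmax i T j hi hT hj (by omega) (by omega) h2, mul_zero]
    · rcases le_total j i with h2 | h2
      · rw [coef2_comm, hperm1, hmax j T i hj hT hi (by omega) (by omega) (by omega), mul_zero]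
      · rw [hperm1, hmax i T j hi hT hj (by omega) (by omega) (by omega), mul_zero]
  intro a b c ha hb hc hne hac hbc
  rcases lt_or_ge r c with hrc | hrc
  · rw [coef2_contr_F ha hb (by omega) hrc, if_neg (by omega)]
  · exact coef2_contr_F_of_le _ (by omega) (by omega) hrc

/-- The case T > t makes beta a form in e^1, …, e^t (`beta_mem`); the case T = t gives the
triangularity used for independence and spanning. -/
theorem coef2_contr_beta (ht : 4 ≤ t) (hk2 : 2 ≤ k) (hk : k ≤ mOf t) {q T : ℕ} (hq : 2 ≤ q)
    (hT : t ≤ T) : coef2 q (q + 1) (contr T (beta t k)) = if q = k ∧ T = t then 1 else 0 := by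
  obtain ⟨htd, hm0, hm⟩ := decomp (t := t) (by omega)
  by_cases hw : q + (q + 1) + T = t + 2 * k + 1
  · obtain rfl : T = t + 2 * (k - q) := by omega
    rw [beta_eq, map_sum, coef2_sum]
    trans ∑ r ∈ Finset.Icc ⌈((t + 2 * k + 1 : ℕ) : ℚ) / 3⌉₊ (t / 2 + k - 1), betaScalar t k r *
        ((t + 2 * (k - q) - r).choose (r - q) : ZMod 2)
    · refine Finset.sum_congr rfl fun r hr => ?_
      have hr' := beta_range ht hk hr
      rw [map_smul, coef2_smul, coef2_contr_F hq (by omega) (by omega) (by omega),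
        if_pos (by omega), ← Nat.cast_add]
      congr 2
      -- By symmetry the binomial at x - q becomes the one at r - q - 1, and Pascal's rule merges
      -- the two.
      rw [show t + 2 * (k - q) - r = (t + 2 * (k - q) - r - 1) + 1 by omega, ← binom_cast,
        binom_succ, Nat.add_sub_cancel, add_comm, ← binom_symm _ (((r - q : ℕ) : ℤ) - 1)]
      congr 2 <;> omega
    · have := sum_binom_eq htd hm hk2 hk (q := q) (by omega) (by omega) (Or.inl hq)
        (ceil_le_iff t k)
      simp only [betaScalar]
      rw [this, if_neg (show ¬ q = 1 by omega), add_zero]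
      simp only [show (q = k ∧ t + 2 * (k - q) = t) ↔ q = k by omega]
  · rw [coef2_contr_beta_weight ht hk hq (by omega) (by omega) hw, if_neg (by omega)]

end Beta

/-! ### Closed two-forms and the support of closed three-forms -/

/-- A closed two-form is determined by its coefficients next to the diagonal. -/
theorem coef2_closed {y : Forms} (hD : D y = 0) : ∀ l i j : ℕ, 2 ≤ i → j = i + 1 + 2 * l →
    coef2 i j y = coef2 (i + l) (i + l + 1) y := by
  intro l
  induction l with
  | zero => intro i j hi hj; subst hj; rfl
  | succ l ih =>
    intro i j hi hj
    have h := coef2_D i (j - 1) hi (by omega) y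
    rw [hD, show j - 1 + 1 = j by omega] at h
    rw [← eq_of_add_eq_zero_two (h.symm.trans (by simp [coef2])), ih (i + 1) (j - 1) (by omega)
      (by omega)]
    congr 1 <;> omega

/-- Moving inwards along i + j constant, one ends on the diagonal, where the coefficient is zero. -/
theorem coef2_closed_even {y : Forms} (hD : D y = 0) : ∀ l i j : ℕ, 2 ≤ i → j = i + 2 * l →
    coef2 i j y = 0 := by
  intro l
  induction l with
  | zero => intro i j hi hj; rw [hj]; exact coef2_self i y
  | succ l ih =>
    intro i j hi hj
    have h := coef2_D i (j - 1) hi (by omega) y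
    rw [hD, show j - 1 + 1 = j by omega] at h
    rw [← eq_of_add_eq_zero_two (h.symm.trans (by simp [coef2])), ih (i + 1) (j - 1) (by omega)
      (by omega)]

theorem coef2_eq_zero_of_closed {y : Forms} (hD : D y = 0) (h1 : contr 1 y = 0)
    (h : ∀ q, 2 ≤ q → coef2 q (q + 1) y = 0) (i j : ℕ) (hij : i < j) : coef2 i j y = 0 := by
  have h0 : contr 0 y = 0 := contr_zero_index y
  rcases Nat.lt_or_ge i 2 with hi | hi
  · rw [coef2_comm]
    obtain rfl | rfl : i = 0 ∨ i = 1 := by omega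
    · rw [coef2, h0, map_zero, map_zero]
    · rw [coef2, h1, map_zero, map_zero]
  · obtain ⟨l, hl | hl⟩ : ∃ l, j = i + 1 + 2 * l ∨ j = i + 2 * l := by
      rcases Nat.even_or_odd' (j - i) with ⟨l, hl | hl⟩
      · exact ⟨l, Or.inr (by omega)⟩
      · exact ⟨l, Or.inl (by omega)⟩
    · rw [coef2_closed hD l i j hi hl, h _ (by omega)]
    · exact coef2_closed_even hD l i j hi hl

theorem two_form_eq_zero_of_closed {n : ℕ} {y : Forms} (hy : y ∈ W n ^ 2) (hD : D y = 0)
    (h1 : contr 1 y = 0) (h : ∀ q, 2 ≤ q → coef2 q (q + 1) y = 0) : y = 0 :=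
  two_form_eq_zero hy (coef2_eq_zero_of_closed hD h1 h)

/-- Descending induction on T: once the contraction by T + 1 is zero, the contraction by T is
closed, hence zero by its coefficients next to the diagonal. -/
theorem three_cocycle_mem {n t : ℕ} (ht : 1 ≤ t) {x : Forms} (hx : x ∈ W n ^ 3) (hD : D x = 0)
    (h1 : contr 1 x = 0)
    (h : ∀ T q, t < T → 2 ≤ q → coef2 q (q + 1) (contr T x) = 0) : x ∈ W t ^ 3 := by
  refine three_form_mem hx fun T hT => ?_
  have key : ∀ l T, t < T → n < T + l → contr T x = 0 := by
    intro l
    induction l with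
    | zero => intro T _ hT'; exact contr_eq_zero hT' x hx
    | succ l ih =>
      intro T hT hT'
      have hD' : D (contr T x) = 0 := by
        have := contr_D T (by omega) x
        rw [hD, map_zero, ih (T + 1) (by omega) (by omega), add_zero] at this
        exact this.symm
      exact two_form_eq_zero_of_closed (contr_mem T x hx) hD'
        (by rw [contr_comm, h1, map_zero]) (fun q hq => h T q hT hq)
  exact key (n + 1) T hT (by omega)

theorem beta_mem {t k : ℕ} (ht : 4 ≤ t) (hk2 : 2 ≤ k) (hk : k ≤ mOf t) : beta t k ∈ W t ^ 3 := by
  obtain ⟨N, hN⟩ := beta_mem_aux t k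
  refine three_cocycle_mem (by omega) hN (D_beta ht hk) (contr_one_beta ht hk) fun T q hT hq => ?_
  rw [coef2_contr_beta ht hk2 hk hq hT.le, if_neg (by omega)]

/-! ### The reversed pairing -/

section Pairing

/-- The action of one-forms by contractions with respect to the reversed basis
`e^i ↦ e^{t+1-i}`. -/
def revOne (t : ℕ) : (ℕ+ →₀ ZMod 2) →ₗ[ZMod 2] Module.End (ZMod 2) Forms :=
  Finsupp.linearCombination (ZMod 2) (fun i : ℕ+ => contr (t + 1 - i))

theorem revOne_comm (t : ℕ) (v w : ℕ+ →₀ ZMod 2) :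
    revOne t v * revOne t w = revOne t w * revOne t v := by
  have h : ∀ a (v : ℕ+ →₀ ZMod 2), contr a * revOne t v = revOne t v * contr a := by
    intro a v
    induction v using Finsupp.induction_linear with
    | zero => simp
    | add u v hu hv => rw [map_add, mul_add, add_mul, hu, hv]
    | single i r =>
      rw [revOne, Finsupp.linearCombination_single, mul_smul_comm, smul_mul_assoc]
      congr 1
      exact LinearMap.ext fun x => contr_comm _ _ _
  induction v using Finsupp.induction_linear with
  | zero => simp
  | add u v hu hv => rw [map_add, mul_add, add_mul, hu, hv]
  | single i r =>
    rw [revOne, Finsupp.linearCombination_single, mul_smul_comm, smul_mul_assoc]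
    congr 1
    exact h _ _

theorem revOne_sq (t : ℕ) (v : ℕ+ →₀ ZMod 2) : revOne t v * revOne t v = 0 := by
  induction v using Finsupp.induction_linear with
  | zero => simp
  | add u v hu hv =>
    rw [map_add, mul_add, add_mul, add_mul, hu, hv, revOne_comm t u v, zero_add, add_zero,
      add_self_two]
  | single i r =>
    rw [revOne, Finsupp.linearCombination_single, mul_smul_comm, smul_mul_assoc]
    rw [show contr (t + 1 - i) * contr (t + 1 - i) = 0 from
      LinearMap.ext fun x => contr_contr_self _ x, smul_zero, smul_zero]

/-- The action of forms by iterated contractions with respect to the reversed basis. -/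
def rev (t : ℕ) : Forms →ₐ[ZMod 2] Module.End (ZMod 2) Forms :=
  ExteriorAlgebra.lift (ZMod 2) ⟨revOne t, revOne_sq t⟩

theorem rev_ee (t i : ℕ) (hi : 1 ≤ i) : rev t (ee i) = contr (t + 1 - i) := by
  rw [ee, dif_pos (by omega), rev, ExteriorAlgebra.lift_ι_apply, revOne,
    Finsupp.linearCombination_single, one_smul]
  rfl

theorem rev_contr (t a : ℕ) (x y : Forms) : rev t x (contr a y) = contr a (rev t x y) := by
  have h : rev t x * contr a = contr a * rev t x := by
    induction x using ExteriorAlgebra.induction with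
    | algebraMap r => rw [AlgHom.commutes, Algebra.commutes]
    | add x y hx hy => rw [map_add, add_mul, mul_add, hx, hy]
    | mul x y hx hy => rw [map_mul, mul_assoc, hy, ← mul_assoc, hx, mul_assoc]
    | ι v =>
      refine forms_hom_ext
        (LinearMap.mulRight (ZMod 2) (contr a : Module.End (ZMod 2) Forms) ∘ₗ (rev t).toLinearMap)
        (LinearMap.mulLeft (ZMod 2) (contr a : Module.End (ZMod 2) Forms) ∘ₗ (rev t).toLinearMap)
        (fun i hi => ?_) v
      change rev t (ee i) * contr a = contr a * rev t (ee i)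
      rw [rev_ee t i hi]
      exact LinearMap.ext fun x => contr_comm _ _ _
  exact LinearMap.congr_fun h y

/-- Adjointness of `D` with respect to the reversed pairing, up to the boundary term. -/
theorem rev_D {t : ℕ} (ht : 3 ≤ t) (q : ℕ) : ∀ x ∈ W t ^ q, ∀ y : Forms,
    (∀ T, t ≤ T → contr T y = 0) →
    rev t (D x) y + (rev t x (D y) + D (rev t x y)) = rev t (contr t x) (contr 2 y) := by
  induction q with
  | zero =>
    intro x hx y _
    rw [pow_zero, Submodule.mem_one] at hx
    obtain ⟨r, rfl⟩ := hx
    rw [D, extDeriv_algebraMap, ← D, show contr t (algebraMap _ _ r) = 0 from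
      extDeriv_algebraMap _ r, AlgHom.commutes, map_zero, LinearMap.zero_apply,
      LinearMap.zero_apply, Module.algebraMap_end_apply, Module.algebraMap_end_apply, map_smul,
      add_self_two, add_zero]
  | succ q ih =>
    refine W_pow_induction (fun y _ => by simp) (fun x x' hx hx' y hy => ?_) ?_
    · simp only [map_add, LinearMap.add_apply, ← hx y hy, ← hx' y hy]
      abel
    · intro i hi z hz y hy
      have hy' : ∀ T, t ≤ T → contr T (rev t z y) = 0 := fun T hT => by
        rw [← rev_contr, hy T hT, map_zero]
      have hone : ∀ y : Forms, (∀ T, t ≤ T → contr T y = 0) →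
          rev t (D (ee i)) y + (rev t (ee i) (D y) + D (rev t (ee i) y)) =
            rev t (contr t (ee i)) (contr 2 y) := by
        intro y hy
        rcases Nat.eq_zero_or_pos i with rfl | h0
        · simp [ee_zero]
        rw [rev_ee t i h0, D_ee, contr_ee]
        -- For i = t the boundary term appears, since e^{t-1} acts as `contr 2` and `contr 1`
        -- commutes with `D`. For i < t the commutator `contr (t+2-i)` cancels against D e^i, or
        -- kills y when i ≤ 2.
        rcases hi.eq_or_lt with rfl | hlt
        · rw [if_pos (by omega), rev_ee _ _ (by omega), if_pos (by omega),
            show i + 1 - i = 1 by omega, show i + 1 - (i - 1) = 2 by omega, contr_one_D,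
            add_self_two, add_zero, map_one, Module.End.one_apply]
        rw [if_neg (show ¬ (t = i ∧ 0 < t) by omega), map_zero, LinearMap.zero_apply,
          contr_D _ (by omega), add_right_comm, add_self_two, zero_add]
        split_ifs with h3
        · rw [rev_ee _ _ (by omega), show t + 1 - (i - 1) = t + 1 - i + 1 by omega, add_self_two]
        · rw [map_zero, LinearMap.zero_apply, zero_add, hy _ (by omega)]
      have h1 := hone _ hy'
      have h2 := congrArg (rev t (ee i)) (ih z hz y hy)
      rw [map_add, map_add] at h2
      rw [contr_mul, D_mul]
      simp only [map_add, map_mul, LinearMap.add_apply, Module.End.mul_apply]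
      rw [rev_contr t 2 z y, ← h1, ← h2]
      -- The cross term from the one-form case and from the induction hypothesis is the same and
      -- cancels.
      have h3 := add_self_two (rev t (ee i) (D (rev t z y)))
      generalize rev t (ee i) (D (rev t z y)) = c at h3 ⊢
      generalize rev t (D (ee i)) (rev t z y) = a1
      generalize rev t (ee i) (rev t (D z) y) = a2
      generalize rev t (ee i) (rev t z (D y)) = a3
      generalize D (rev t (ee i) (rev t z y)) = a4
      have : a1 + (c + a4) + (a2 + (a3 + c)) = a1 + a2 + (a3 + a4) + (c + c) := by abel
      rw [this, h3, add_zero]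

end Pairing

/-! ### Vanishing of the other leading coefficients -/

theorem sum_range_choose_col (N j : ℕ) :
    ∑ l ∈ Finset.range N, l.choose j = N.choose (j + 1) := by
  induction N with
  | zero => simp
  | succ N ih => rw [Finset.sum_range_succ, ih, Nat.choose_succ_succ', add_comm]

/-- The sum of the coefficients of the terms `e^2 ∧ e^A ∧ e^B` of `F(e^x ∧ e^r, e^r)`. -/
theorem sum_coef2_contr_two_F {e r : ℕ} (he : 1 ≤ e) (hr : 2 * e < r) :
    ∑ A ∈ Finset.Icc 2 (e + r - 1),
      coef2 A (2 * e + 2 * r - 1 - A) (contr 2 (F (ee (2 * e) * ee r) r)) =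
      ((2 * e + r - 2).choose (r - 1) : ZMod 2) := by
  have hterm : ∀ A ∈ Finset.Icc 2 (e + r - 1),
      coef2 A (2 * e + 2 * r - 1 - A) (contr 2 (F (ee (2 * e) * ee r) r)) =
      (((2 * e + r - 2 - A).choose (2 * e - 2) + (2 * e + r - 2 - A).choose (r - 2) : ℕ) :
        ZMod 2) := by
    intro A hA
    have hA' := Finset.mem_Icc.mp hA
    have hperm : ∀ (a b c : ℕ) (z : Forms), coef2 a b (contr c z) = coef2 c a (contr b z) := by
      intro a b c z
      rw [coef2, contr_comm b c, contr_comm a c, coef2]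
    rw [hperm, coef2_contr_F le_rfl (by omega) (by omega) (by omega), if_pos (by omega),
      show 2 * e + 2 * r - 1 - A - r - 1 = 2 * e + r - 2 - A by omega, ← Nat.cast_add,
      ← binom_cast, ← binom_cast]
    congr 3 <;> omega
  rw [Finset.sum_congr rfl hterm, ← Nat.cast_sum]
  congr 1
  have h1 : ∑ A ∈ Finset.Icc 2 (e + r - 1),
      ((2 * e + r - 2 - A).choose (2 * e - 2) + (2 * e + r - 2 - A).choose (r - 2)) =
      ∑ l ∈ Finset.Ico (e - 1) (2 * e + r - 3), (l.choose (2 * e - 2) + l.choose (r - 2)) := by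
    refine Finset.sum_nbij' (fun A => 2 * e + r - 2 - A) (fun l => 2 * e + r - 2 - l) ?_ ?_ ?_ ?_ ?_
    · intro A hA
      have := Finset.mem_Icc.mp hA
      exact Finset.mem_Ico.mpr (by omega)
    · intro l hl
      have := Finset.mem_Ico.mp hl
      exact Finset.mem_Icc.mpr (by omega)
    · intro A hA
      have := Finset.mem_Icc.mp hA
      change 2 * e + r - 2 - (2 * e + r - 2 - A) = A
      omega
    · intro l hl
      have := Finset.mem_Ico.mp hl
      change 2 * e + r - 2 - (2 * e + r - 2 - l) = l
      omega
    · intro A _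
      rfl
  have h2 : ∑ l ∈ Finset.Ico (e - 1) (2 * e + r - 3), (l.choose (2 * e - 2) + l.choose (r - 2)) =
      ∑ l ∈ Finset.range (2 * e + r - 3), (l.choose (2 * e - 2) + l.choose (r - 2)) := by
    refine Finset.sum_subset (fun l hl => ?_) fun l hl hl' => ?_
    · exact Finset.mem_range.mpr (Finset.mem_Ico.mp hl).2
    · have h3 := Finset.mem_range.mp hl
      have h4 : ¬ (e - 1 ≤ l ∧ l < 2 * e + r - 3) := fun h => hl' (Finset.mem_Ico.mpr h)
      rw [Nat.choose_eq_zero_of_lt (by omega), Nat.choose_eq_zero_of_lt (by omega), add_zero]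
  -- With N = 2e + r - 3 the column sums are the binomials of N at 2e - 1 and r - 1; the first
  -- equals that at r - 2, so Pascal's rule applies.
  rw [h1, h2, Finset.sum_add_distrib, sum_range_choose_col, sum_range_choose_col,
    show 2 * e + r - 2 = (2 * e + r - 3) + 1 by omega, show r - 1 = (r - 2) + 1 by omega,
    Nat.choose_succ_succ', ← Nat.choose_symm (show 2 * e - 2 + 1 ≤ 2 * e + r - 3 by omega)]
  congr 2
  omega

/-- This is `sum_binom_eq` at q = 1 with m = 2^p, where the top coefficient supplies the 1. -/
theorem sum_coef2_contr_two_beta {p k : ℕ} (hp : 1 ≤ p) (hk2 : 2 ≤ k) (hk : k ≤ 2 ^ p) :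
    ∑ A ∈ Finset.Icc 2 (2 ^ p + k - 1),
      coef2 A (2 * 2 ^ p + 2 * k - 1 - A) (contr 2 (beta (2 ^ (p + 1)) k)) = 1 := by
  have h2p : 2 ≤ 2 ^ p := by
    calc 2 = 2 ^ 1 := rfl
      _ ≤ 2 ^ p := Nat.pow_le_pow_right (by norm_num) hp
  have ht : 2 ^ (p + 1) = 2 ^ p + 2 ^ p := by rw [pow_succ]; ring
  obtain ⟨hpp, hmm⟩ := (pOf_mOf_iff (2 ^ (p + 1)) (by omega) p (2 ^ p)).mp
    ⟨ht, by omega, le_rfl⟩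
  have hsum := sum_binom_eq ht le_rfl hk2 hk (q := 1) le_rfl (by omega) (Or.inr rfl)
    (ceil_le_iff (2 ^ (p + 1)) k)
  rw [if_neg (by omega), if_pos rfl, zero_add] at hsum
  rw [← hsum, beta_eq]
  simp only [map_sum, coef2_sum]
  rw [Finset.sum_comm]
  refine Finset.sum_congr rfl fun r hr => ?_
  have hr' := beta_range (t := 2 ^ (p + 1)) (by omega) (by omega) hr
  simp only [map_smul, coef2_smul, betaScalar, ← hpp, ← hmm]
  rw [← Finset.mul_sum]
  congr 1
  obtain ⟨e, he⟩ : ∃ e, 2 ^ p + k - r = e := ⟨_, rfl⟩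
  have := sum_coef2_contr_two_F (e := e) (r := r) (by omega) (by omega)
  rw [show 2 ^ (p + 1) + 2 * k - 2 * r = 2 * e by omega,
    show 2 ^ p + k - 1 = e + r - 1 by omega,
    show 2 * 2 ^ p + 2 * k - 1 = 2 * e + 2 * r - 1 by omega, this]
  congr 2
  omega

/-- Closedness carries the coefficient at (k, k+1) to (2, 2k-1). As 2k - 1 ≥ t, this would need e^t
twice or an index beyond t. -/
theorem leading_coef_eq_zero_of_lt {t k : ℕ} (ht : 2 ≤ t) {x : Forms} (hx : x ∈ W t ^ 3)
    (hD : D x = 0) (hk2 : 2 ≤ k) (hk : t < 2 * k) : coef2 k (k + 1) (contr t x) = 0 := by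
  have hD' : D (contr t x) = 0 := by
    have := contr_D t ht x
    rw [hD, map_zero, contr_eq_zero (Nat.lt_succ_self t) x hx, add_zero] at this
    exact this.symm
  have h := coef2_closed hD' (k - 2) 2 (2 * k - 1) le_rfl (by omega)
  rw [show 2 + (k - 2) = k by omega] at h
  rw [← h, coef2]
  rcases (show t ≤ 2 * k - 1 by omega).eq_or_lt with h' | h'
  · rw [← h', contr_contr_self, map_zero, map_zero]
  · rw [contr_comm (2 * k - 1), contr_eq_zero h' x hx, map_zero, map_zero, map_zero]

/-- Both x and a suitable beta are closed, so `rev_D` makes the pairing of their boundary parts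
vanish; that pairing is the leading coefficient itself. -/
theorem leading_coef_eq_zero_of_mOf_lt {t k : ℕ} (ht : 4 ≤ t) {x : Forms} (hx : x ∈ W t ^ 3)
    (h1 : contr 1 x = 0) (hD : D x = 0) (hk : mOf t < k) (hkt : 2 * k ≤ t) :
    coef2 k (k + 1) (contr t x) = 0 := by
  obtain ⟨htd, hm0, hm⟩ := decomp (t := t) (by omega)
  obtain ⟨p, hp⟩ : ∃ p, pOf t = p + 1 := by
    refine ⟨pOf t - 1, ?_⟩
    rcases Nat.eq_zero_or_pos (pOf t) with h | h
    · rw [h] at htd hm; omega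
    · omega
  set m := mOf t with hmdef
  rw [hp] at htd hm
  have hpow : 2 ^ (p + 1) = 2 * 2 ^ p := by rw [pow_succ]; ring
  have hp1 : 1 ≤ p := by
    by_contra h
    obtain rfl : p = 0 := by omega
    omega
  have h2p : 2 ≤ 2 ^ p := by
    calc 2 = 2 ^ 1 := rfl
      _ ≤ 2 ^ p := Nat.pow_le_pow_right (by norm_num) hp1
  -- With this k', contracting beta by 2 leaves weight 2t + 1 - 2k, which i ↦ t + 1 - i turns into
  -- 2k + 1. The bounds m < k ≤ t/2 give 2 ≤ k' ≤ 2^p.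
  obtain ⟨k', hk'⟩ : ∃ k', 2 ^ p + m + 1 - k = k' := ⟨_, rfl⟩
  have hmm := ((pOf_mOf_iff (2 ^ (p + 1)) (by omega) p (2 ^ p)).mp
    ⟨by omega, by omega, le_rfl⟩).2
  have hs := sum_coef2_contr_two_beta hp1 (k := k') (by omega) (by omega)
  have hγ : beta (2 ^ (p + 1)) k' ∈ W (2 ^ (p + 1)) ^ 3 :=
    beta_mem (by omega) (by omega) (by omega)
  have hγD : D (beta (2 ^ (p + 1)) k') = 0 := D_beta (by omega) (by omega)
  have hγw : ∀ i j, 2 ≤ i → 2 ≤ j → i + j ≠ 2 * t + 1 - 2 * k →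
      coef2 i j (contr 2 (beta (2 ^ (p + 1)) k')) = 0 := fun i j hi hj hij =>
    coef2_contr_beta_weight (by omega) (by omega) hi hj le_rfl (by omega)
  generalize beta (2 ^ (p + 1)) k' = γ at *
  have hpair := congrArg eps (rev_D (t := t) (by omega) 3 x hx γ
    (fun T hT => contr_eq_zero (by omega) γ hγ))
  rw [hD, hγD, map_zero, map_zero, LinearMap.zero_apply, zero_add, zero_add, eps_D] at hpair
  have hω : contr t x ∈ W t ^ 2 := contr_mem t x hx
  have hωD : D (contr t x) = 0 := by
    have := contr_D t (by omega) x
    rw [hD, map_zero, contr_eq_zero (Nat.lt_succ_self t) x hx, add_zero] at this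
    exact this.symm
  have hω1 : contr 1 (contr t x) = 0 := by rw [contr_comm, h1, map_zero]
  have hωt : contr t (contr t x) = 0 := contr_contr_self _ _
  generalize contr t x = ω at *
  rw [two_form_expand ω hω] at hpair
  simp only [map_sum, map_smul, LinearMap.sum_apply, LinearMap.smul_apply, smul_eq_mul] at hpair
  -- Weight leaves only pairs with index sum 2k + 1, on which the coefficient of the closed form ω
  -- is constant.
  have hterm : ∀ q ∈ (Finset.range (t + 1) ×ˢ Finset.range (t + 1)).filter (fun q => q.1 < q.2),
      coef2 q.1 q.2 ω * eps (rev t (ee q.1 * ee q.2) (contr 2 γ)) =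
      if 2 ≤ q.1 ∧ q.1 + q.2 = 2 * k + 1 then
        coef2 k (k + 1) ω * coef2 (t + 1 - q.1) (t - 2 * k + q.1) (contr 2 γ) else 0 := by
    rintro ⟨a, b⟩ hq
    simp only [Finset.mem_filter, Finset.mem_product, Finset.mem_range] at hq
    simp only
    rcases Nat.lt_or_ge a 2 with ha | ha
    · rw [if_neg (by omega), coef2_comm]
      obtain rfl | rfl : a = 0 ∨ a = 1 := by omega
      · rw [coef2, contr_zero_index, map_zero, map_zero, zero_mul]
      · rw [coef2, hω1, map_zero, map_zero, zero_mul]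
    rw [map_mul, rev_ee t a (by omega), rev_ee t b (by omega), Module.End.mul_apply]
    change _ * coef2 _ _ (contr 2 γ) = _
    rcases (show b ≤ t by omega).eq_or_lt with hb | hb
    · rw [if_neg (by omega), coef2, hb, hωt, map_zero, map_zero, zero_mul]
    split_ifs with hab
    · rw [coef2_closed hωD (k - a) a b ha (by omega), show a + (k - a) = k by omega,
        show t + 1 - b = t - 2 * k + a by omega]
    · rw [hγw _ _ (by omega) (by omega) (by omega), mul_zero]
  rw [Finset.sum_congr rfl hterm, ← Finset.sum_filter, ← Finset.mul_sum] at hpair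
  have hone : ∑ q ∈ ((Finset.range (t + 1) ×ˢ Finset.range (t + 1)).filter
      (fun q => q.1 < q.2)).filter (fun q => 2 ≤ q.1 ∧ q.1 + q.2 = 2 * k + 1),
      coef2 (t + 1 - q.1) (t - 2 * k + q.1) (contr 2 γ) = 1 := by
    -- The additional indices A < t - 2k + 2 have a partner at least t > 2^(p+1), outside the
    -- support of γ.
    have hsub : Finset.Icc (t - 2 * k + 2) (t - k) ⊆ Finset.Icc 2 (2 ^ p + k' - 1) := by
      intro A hA
      have := Finset.mem_Icc.mp hA
      exact Finset.mem_Icc.mpr (by omega)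
    rw [← hs, ← Finset.sum_subset hsub]
    · refine Finset.sum_nbij' (fun q => t - 2 * k + q.1)
        (fun A => (A - (t - 2 * k), t + 1 - A)) ?_ ?_ ?_ ?_ ?_
      · rintro ⟨a, b⟩ hq
        simp only [Finset.mem_filter, Finset.mem_product, Finset.mem_range] at hq
        exact Finset.mem_Icc.mpr (by simp only; omega)
      · intro A hA
        have := Finset.mem_Icc.mp hA
        simp only [Finset.mem_filter, Finset.mem_product, Finset.mem_range]
        omega
      · rintro ⟨a, b⟩ hq
        simp only [Finset.mem_filter, Finset.mem_product, Finset.mem_range] at hq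
        refine Prod.ext ?_ ?_ <;> simp only <;> omega
      · intro A hA
        have := Finset.mem_Icc.mp hA
        simp only
        omega
      · rintro ⟨a, b⟩ hq
        simp only [Finset.mem_filter, Finset.mem_product, Finset.mem_range] at hq
        simp only
        rw [coef2_comm]
        congr 1
        omega
    · intro A hA hA'
      have h3 := Finset.mem_Icc.mp hA
      have h4 : ¬ (t - 2 * k + 2 ≤ A ∧ A ≤ t - k) := fun h => hA' (Finset.mem_Icc.mpr h)
      rw [coef2, contr_eq_zero (n := 2 ^ (p + 1)) (by omega) _ (contr_mem 2 γ hγ), map_zero,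
        map_zero]
  rw [hone, mul_one] at hpair
  exact hpair.symm

/-! ### The kernel of D on three-forms without e^1 -/

/-- The closed three-forms without `e^1` are spanned by the forms `beta`. -/
theorem mem_span_beta (n : ℕ) : ∀ x ∈ W n ^ 3, contr 1 x = 0 → D x = 0 →
    x ∈ Submodule.span (ZMod 2)
      {y | ∃ t k, (4 ≤ t ∧ t ≤ n) ∧ (2 ≤ k ∧ k ≤ mOf t) ∧ beta t k = y} := by
  induction n with
  | zero =>
    intro x hx _ _
    have := three_form_expand x hx
    rw [Finset.sum_range_one, ee_zero, zero_mul] at this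
    rw [this]
    exact zero_mem _
  | succ n ih =>
    intro x hx h1 hD
    have hmono : Submodule.span (ZMod 2)
        {y | ∃ t k, (4 ≤ t ∧ t ≤ n) ∧ (2 ≤ k ∧ k ≤ mOf t) ∧ beta t k = y} ≤
        Submodule.span (ZMod 2)
        {y | ∃ t k, (4 ≤ t ∧ t ≤ n + 1) ∧ (2 ≤ k ∧ k ≤ mOf t) ∧ beta t k = y} := by
      refine Submodule.span_mono ?_
      rintro _ ⟨t, k, ht, hk, rfl⟩
      exact ⟨t, k, by omega, hk, rfl⟩
    have hlast : ∀ x ∈ W (n + 1) ^ 3, contr 1 x = 0 → D x = 0 →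
        (2 ≤ n + 1 → ∀ k, 2 ≤ k → coef2 k (k + 1) (contr (n + 1) x) = 0) → x ∈ Submodule.span (ZMod 2)
        {y | ∃ t k, (4 ≤ t ∧ t ≤ n) ∧ (2 ≤ k ∧ k ≤ mOf t) ∧ beta t k = y} := by
      intro x hx h1 hD h
      refine ih x (three_form_mem hx fun T hT => ?_) h1 hD
      rcases (show n + 1 ≤ T from hT).eq_or_lt with rfl | hT'
      · rcases Nat.eq_zero_or_pos n with rfl | hn
        · exact h1
        have hD' : D (contr (n + 1) x) = 0 := by
          have := contr_D (n + 1) (by omega) x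
          rw [hD, map_zero, contr_eq_zero (Nat.lt_succ_self _) x hx, add_zero] at this
          exact this.symm
        exact two_form_eq_zero_of_closed (contr_mem _ x hx) hD'
          (by rw [contr_comm, h1, map_zero]) (h (by omega))
      · exact contr_eq_zero hT' x hx
    rcases Nat.lt_or_ge (n + 1) 4 with hn | hn
    · refine hmono (hlast x hx h1 hD fun hn2 k hk => ?_)
      exact leading_coef_eq_zero_of_lt hn2 hx hD hk (by omega)
    -- Adding z removes all admissible leading coefficients of x; the inadmissible ones vanish
    -- already, so x + z has no e^{n+1}.
    set z := ∑ k ∈ Finset.Icc 2 (mOf (n + 1)),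
      coef2 k (k + 1) (contr (n + 1) x) • beta (n + 1) k with hz
    have hzmem : z ∈ Submodule.span (ZMod 2)
        {y | ∃ t k, (4 ≤ t ∧ t ≤ n + 1) ∧ (2 ≤ k ∧ k ≤ mOf t) ∧ beta t k = y} := by
      refine Submodule.sum_mem _ fun k hk => Submodule.smul_mem _ _ (Submodule.subset_span ?_)
      exact ⟨n + 1, k, ⟨hn, le_rfl⟩, Finset.mem_Icc.mp hk, rfl⟩
    have hzW : z ∈ W (n + 1) ^ 3 := by
      refine Submodule.sum_mem _ fun k hk => Submodule.smul_mem _ _ ?_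
      exact beta_mem hn (Finset.mem_Icc.mp hk).1 (Finset.mem_Icc.mp hk).2
    have hz1 : contr 1 z = 0 := by
      rw [hz, map_sum]
      refine Finset.sum_eq_zero fun k hk => ?_
      rw [map_smul, contr_one_beta hn (Finset.mem_Icc.mp hk).2, smul_zero]
    have hzD : D z = 0 := by
      rw [hz, map_sum]
      refine Finset.sum_eq_zero fun k hk => ?_
      rw [map_smul, D_beta hn (Finset.mem_Icc.mp hk).2, smul_zero]
    have hxz : x + z ∈ Submodule.span (ZMod 2)
        {y | ∃ t k, (4 ≤ t ∧ t ≤ n + 1) ∧ (2 ≤ k ∧ k ≤ mOf t) ∧ beta t k = y} := by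
      refine hmono (hlast _ (add_mem hx hzW) (by rw [map_add, h1, hz1, add_zero])
        (by rw [map_add, hD, hzD, add_zero]) fun _ k hk => ?_)
      rw [map_add, coef2_add, hz, map_sum, coef2_sum]
      have hterm : ∀ j ∈ Finset.Icc 2 (mOf (n + 1)),
          coef2 k (k + 1) (contr (n + 1) (coef2 j (j + 1) (contr (n + 1) x) • beta (n + 1) j)) =
          if k = j then coef2 k (k + 1) (contr (n + 1) x) else 0 := by
        intro j hj
        rw [map_smul, coef2_smul,
          coef2_contr_beta hn (Finset.mem_Icc.mp hj).1 (Finset.mem_Icc.mp hj).2 hk le_rfl]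
        by_cases hkj : k = j
        · subst hkj; simp
        · simp [hkj]
      rw [Finset.sum_congr rfl hterm, Finset.sum_ite_eq]
      split_ifs with hkm
      · exact add_self_two _
      · rw [add_zero]
        rw [Finset.mem_Icc] at hkm
        rcases Nat.lt_or_ge (n + 1) (2 * k) with h | h
        · exact leading_coef_eq_zero_of_lt (by omega) hx hD hk h
        · exact leading_coef_eq_zero_of_mOf_lt hn hx h1 hD (by omega) h
    have := add_mem hxz hzmem
    rwa [add_assoc, add_self_two, add_zero] at this

/-- The forms `beta` are linearly independent. -/
theorem beta_independent {J : Type*} (s : Finset J) (t k : J → ℕ)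
    (hinj : ∀ i j, t i = t j → k i = k j → i = j) (ht : ∀ j, 4 ≤ t j) (hk2 : ∀ j, 2 ≤ k j)
    (hk : ∀ j, k j ≤ mOf (t j)) (b : J → ZMod 2)
    (h : ∑ j ∈ s, b j • beta (t j) (k j) = 0) : ∀ j ∈ s, b j = 0 := by
  by_contra hne
  push Not at hne
  obtain ⟨j₀, hj₀, hb⟩ := hne
  -- For a term of maximal level t, its leading coefficient functional kills every other term with
  -- nonzero scalar.
  obtain ⟨i, hi, hmax⟩ := Finset.exists_max_image (s.filter fun j => b j ≠ 0) t
    ⟨j₀, Finset.mem_filter.mpr ⟨hj₀, hb⟩⟩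
  have hi' := Finset.mem_filter.mp hi
  have h0 := congrArg (fun x => coef2 (k i) (k i + 1) (contr (t i) x)) h
  simp only [map_sum, coef2_sum, map_smul, coef2_smul] at h0
  rw [Finset.sum_eq_single i] at h0
  · rw [coef2_contr_beta (ht i) (hk2 i) (hk i) (hk2 i) le_rfl, if_pos ⟨rfl, rfl⟩, mul_one] at h0
    exact hi'.2 (h0.trans (by simp [coef2]))
  · intro j hj hji
    by_cases hbj : b j = 0
    · rw [hbj, zero_mul]
    have := hmax j (Finset.mem_filter.mpr ⟨hj, hbj⟩)
    rw [coef2_contr_beta (ht j) (hk2 j) (hk j) (hk2 i) this, if_neg, mul_zero]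
    rintro ⟨h1, h2⟩
    exact hji (hinj j i h2.symm h1.symm)
  · intro hni
    exact absurd hi'.1 hni

/-! ### The cokernel of D on two-forms without e^1 -/

section TwoForms

/-- D(e^a ∧ e^{b+1}) = e^{a-1} ∧ e^{b+1} + e^a ∧ e^b lowers a until e^2, where the first term is
absent. The bound on a + b keeps all indices at most n. -/
theorem ee_mul_ee_mem_image {n : ℕ} (a : ℕ) : ∀ b, 2 ≤ a → 2 ≤ b → a + b ≤ n + 1 →
    ee a * ee b ∈ (W n ^ 2).map D := by
  induction a with
  | zero => intro b h; omega
  | succ a ih =>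
    intro b ha hb hab
    have h := D_mul (ee (a + 1)) (ee (b + 1))
    rw [D_ee, D_ee, if_pos (show 3 ≤ b + 1 by omega), Nat.add_sub_cancel, Nat.add_sub_cancel] at h
    have hmem : D (ee (a + 1) * ee (b + 1)) ∈ (W n ^ 2).map D :=
      Submodule.mem_map_of_mem (ee_mul_ee_mem (by omega) (by omega))
    rw [h] at hmem
    split_ifs at hmem with h3
    · have := add_mem (ih (b + 1) (by omega) (by omega) (by omega)) hmem
      rwa [← add_assoc, add_self_two, zero_add] at this
    · rwa [zero_mul, zero_add] at hmem

theorem ee_mul_ee_mem_sup {n : ℕ} (l : ℕ) : ∀ a b, 2 ≤ a → b ≤ n → b = a + l →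
    ee a * ee b ∈ Submodule.span (ZMod 2)
      {y | ∃ i, (2 + n / 2 ≤ i ∧ i ≤ n) ∧ ee (i - 1) * ee i = y} ⊔ (W n ^ 2).map D := by
  induction l using Nat.strong_induction_on with
  | _ l ih =>
    intro a b ha hb hab
    match l, ih with
    | 0, _ =>
      rw [hab, Nat.add_zero, ee_mul_self]
      exact zero_mem _
    | 1, _ =>
      rcases Nat.lt_or_ge b (2 + n / 2) with h | h
      · exact Submodule.mem_sup_right (ee_mul_ee_mem_image a b ha (by omega) (by omega))
      · exact Submodule.mem_sup_left (Submodule.subset_span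
          ⟨b, ⟨h, hb⟩, by rw [show b - 1 = a by omega]⟩)
    | l + 2, ih =>
      have h := D_mul (ee (a + 1)) (ee b)
      rw [D_ee, D_ee, if_pos (by omega), if_pos (by omega), Nat.add_sub_cancel] at h
      have hmem : D (ee (a + 1) * ee b) ∈ (W n ^ 2).map D :=
        Submodule.mem_map_of_mem (ee_mul_ee_mem (by omega) (by omega))
      rw [h] at hmem
      have := add_mem (Submodule.mem_sup_right hmem)
        (ih l (by omega) (a + 1) (b - 1) (by omega) (by omega) (by omega))
      rwa [add_assoc, add_self_two, add_zero] at this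

theorem two_form_mem_sup {n : ℕ} {y : Forms} (hy : y ∈ W n ^ 2) (h1 : contr 1 y = 0) :
    y ∈ Submodule.span (ZMod 2)
      {y | ∃ i, (2 + n / 2 ≤ i ∧ i ≤ n) ∧ ee (i - 1) * ee i = y} ⊔ (W n ^ 2).map D := by
  rw [two_form_expand y hy]
  refine Submodule.sum_mem _ fun q hq => ?_
  simp only [Finset.mem_filter, Finset.mem_product, Finset.mem_range] at hq
  rcases Nat.lt_or_ge q.1 2 with ha | ha
  · have : coef2 q.1 q.2 y = 0 := by
      rw [coef2_comm, coef2]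
      obtain h | h : q.1 = 0 ∨ q.1 = 1 := by omega
      · rw [h, contr_zero_index, map_zero, map_zero]
      · rw [h, h1, map_zero, map_zero]
    rw [this, zero_smul]
    exact zero_mem _
  · exact Submodule.smul_mem _ _
      (ee_mul_ee_mem_sup (q.2 - q.1) q.1 q.2 ha (by omega) (by omega))

/-- The forms `e^{i-1} ∧ e^i` in the upper half are independent modulo the image of `D`. -/
theorem two_form_independent {n : ℕ} {J : Type*} (s : Finset J) (f : J → ℕ)
    (hinj : Function.Injective f) (hf : ∀ j, 2 + n / 2 ≤ f j ∧ f j ≤ n) (a : J → ZMod 2)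
    {z : Forms} (hz : z ∈ W n ^ 2)
    (h : ∑ j ∈ s, a j • (ee (f j - 1) * ee (f j)) = D z) : ∀ j ∈ s, a j = 0 := by
  intro i hi
  have hfi := hf i
  -- The functional adds the coefficients with index sum 2 f(i) - 1, from larger index n inwards. On
  -- D z it telescopes to an end with index n + 1 and an end on the diagonal, both zero. The lower
  -- bound on f(i) keeps every index at least 2.
  have h0 := congrArg (fun x => ∑ l ∈ Finset.range (n + 1 - f i),
    coef2 (2 * f i - 1 - n + l) (n - l) x) h
  simp only [coef2_sum, coef2_smul] at h0
  rw [Finset.sum_comm, Finset.sum_eq_single i] at h0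
  · rw [Finset.sum_eq_single (n - f i)] at h0
    · rw [coef2_ee, if_pos (by omega), if_neg (by omega), add_zero, mul_one] at h0
      rw [h0]
      have hterm : ∀ l ∈ Finset.range (n + 1 - f i), coef2 (2 * f i - 1 - n + l) (n - l) (D z) =
          coef2 (2 * f i - 1 - n + l) (n + 1 - l) z -
            coef2 (2 * f i - 1 - n + (l + 1)) (n + 1 - (l + 1)) z := by
        intro l hl
        have := Finset.mem_range.mp hl
        rw [coef2_D _ _ (by omega) (by omega), CharTwo.sub_eq_add, add_comm,
          show n - l + 1 = n + 1 - l by omega, show n + 1 - (l + 1) = n - l by omega, add_assoc]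
      rw [Finset.sum_congr rfl hterm,
        Finset.sum_range_sub' (fun l => coef2 (2 * f i - 1 - n + l) (n + 1 - l) z), coef2,
        Nat.sub_zero, contr_eq_zero (Nat.lt_succ_self n) z hz, map_zero, map_zero,
        show 2 * f i - 1 - n + (n + 1 - f i) = n + 1 - (n + 1 - f i) by omega, coef2_self, sub_zero]
    · intro l hl hne
      have := Finset.mem_range.mp hl
      rw [coef2_ee, if_neg (by omega), if_neg (by omega), add_zero, mul_zero]
    · intro hni
      exact absurd (Finset.mem_range.mpr (by omega)) hni
  · intro j _ hji
    have hfj := hf j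
    have hne : f j ≠ f i := fun h => hji (hinj h)
    refine Finset.sum_eq_zero fun l hl => ?_
    have := Finset.mem_range.mp hl
    rw [coef2_ee, if_neg (by omega), if_neg (by omega), add_zero, mul_zero]
  · intro hni
    exact absurd hi hni

end TwoForms

/-! ### Transfer to the Chevalley-Eilenberg complex -/

section Transfer

variable {n : ℕ}

theorem dual_induction {P : Module.Dual (ZMod 2) (M0 n) → Prop} (h0 : P 0)
    (hadd : ∀ x y, P x → P y → P (x + y)) (hco : ∀ i, i ≤ n → P (M0.co i)) (ξ) : P ξ := by
  rw [← (M0.basis n).sum_dual_apply_smul_coord ξ]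
  refine Finset.sum_induction _ P hadd h0 fun i _ => ?_
  rcases zmod_two_smul_cases (ξ ((M0.basis n) i)) ((M0.basis n).coord i) with h | h <;> rw [h]
  · exact h0
  · rw [M0.basis_coord]
    exact hco i (Finset.mem_Icc.mp i.2).2

theorem map_incl_exteriorPower (n q : ℕ) :
    (⋀[ZMod 2]^q (Module.Dual (ZMod 2) (M0 n))).map (incl n).toLinearMap = W n ^ q := by
  rw [ExteriorAlgebra.exteriorPower, Submodule.map_pow]
  congr 1
  refine le_antisymm ?_ (Submodule.span_le.mpr ?_)
  · rintro _ ⟨_, ⟨ξ, rfl⟩, rfl⟩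
    refine dual_induction (P := fun ξ => (incl n).toLinearMap (ExteriorAlgebra.ι (ZMod 2) ξ) ∈ W n)
      (by simp) (fun x y hx hy => by rw [map_add, map_add]; exact add_mem hx hy)
      (fun i hi => ?_) ξ
    change incl n (M0.form n i) ∈ W n
    rw [incl_form n i hi]
    exact ee_mem_W hi
  · rintro _ ⟨i, hi, rfl⟩
    exact ⟨M0.form n i, ⟨M0.co i, rfl⟩, incl_form n i hi⟩

theorem incl_mem {q : ℕ} {x : ExteriorAlgebra (ZMod 2) (Module.Dual (ZMod 2) (M0 n))}
    (hx : x ∈ ⋀[ZMod 2]^q (Module.Dual (ZMod 2) (M0 n))) : incl n x ∈ W n ^ q := by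
  rw [← map_incl_exteriorPower]
  exact Submodule.mem_map_of_mem (f := (incl n).toLinearMap) hx

theorem exists_incl_eq {q : ℕ} {y : Forms} (hy : y ∈ W n ^ q) :
    ∃ x ∈ ⋀[ZMod 2]^q (Module.Dual (ZMod 2) (M0 n)), incl n x = y := by
  rw [← map_incl_exteriorPower] at hy
  exact hy

/-- Under the inclusion the Chevalley-Eilenberg differential becomes `e^1 ∧ D`. -/
theorem incl_ceD (hn : 1 ≤ n) (x : ExteriorAlgebra (ZMod 2) (Module.Dual (ZMod 2) (M0 n))) :
    incl n (ceD (M0.basis n) x) = ee 1 * D (incl n x) := by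
  induction x using ExteriorAlgebra.induction with
  | algebraMap r =>
    rw [ceD, extDeriv_algebraMap, AlgHom.commutes, D, extDeriv_algebraMap, map_zero, mul_zero]
  | add x y hx hy => rw [map_add, map_add, map_add, map_add, mul_add, hx, hy]
  | mul x y hx hy =>
    rw [show ceD (M0.basis n) (x * y) = ceD (M0.basis n) x * y + x * ceD (M0.basis n) y from
      extDeriv_mul _ x y, map_add, map_mul, map_mul, map_mul, D_mul, hx, hy, mul_add, mul_assoc,
      ← mul_assoc (incl n x), ext_mul_comm (incl n x) (ee 1), mul_assoc]
  | ι ξ =>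
    refine dual_induction (P := fun ξ => incl n (ceD (M0.basis n) (ExteriorAlgebra.ι (ZMod 2) ξ)) =
      ee 1 * D (incl n (ExteriorAlgebra.ι (ZMod 2) ξ))) (by simp)
      (fun x y hx hy => by simp only [map_add, mul_add, hx, hy]) (fun i hi => ?_) ξ
    change incl n (ceD (M0.basis n) (M0.form n i)) = ee 1 * D (incl n (M0.form n i))
    rw [M0.ceD_form i hi, incl_form n i hi, D_ee]
    split_ifs
    · rw [map_mul, incl_form n 1 hn, incl_form n (i - 1) (by omega)]
    · rw [map_zero, mul_zero]

theorem exists_cocycle (hn : 1 ≤ n) {q : ℕ} {y : Forms} (hy : y ∈ W n ^ q)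
    (hD : ee 1 * D y = 0) : ∃ c : cocycles (M0.basis n) q,
      incl n (c : ExteriorAlgebra (ZMod 2) (Module.Dual (ZMod 2) (M0 n))) = y := by
  obtain ⟨x, hx, rfl⟩ := exists_incl_eq hy
  refine ⟨⟨x, hx, LinearMap.mem_ker.mpr ?_⟩, rfl⟩
  apply incl_injective n
  rw [incl_ceD hn, hD, map_zero]

end Transfer

/-! ### Splitting off e^1 and assembling the basis -/

theorem D_ee_one_mul (y : Forms) : D (ee 1 * y) = ee 1 * D y := by
  rw [D_mul, D_ee, if_neg (by omega), zero_mul, zero_add]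

theorem ee_one_mul_ee_one_mul (y : Forms) : ee 1 * (ee 1 * y) = 0 := by
  rw [← mul_assoc, ee_mul_self, zero_mul]

theorem contr_one_ee_one_mul (y : Forms) : contr 1 (ee 1 * y) = y + ee 1 * contr 1 y := by
  rw [contr_mul, contr_ee, if_pos (by omega), one_mul]

theorem eq_zero_of_contr_one {y : Forms} (h1 : contr 1 y = 0) (h : ee 1 * y = 0) : y = 0 := by
  have := contr_one_ee_one_mul y
  rw [h, h1, map_zero, mul_zero, add_zero] at this
  exact this.symm

theorem element_mem {n : ℕ} (hn : 1 ≤ n) (j : Index n) : element n j ∈ W n ^ 3 := by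
  rcases j with ⟨i, hi⟩ | ⟨⟨t, k⟩, ht, hk⟩
  · rw [element, mul_assoc]
    exact ee_mul_mem hn (ee_mul_ee_mem (by simp only; omega) hi.2)
  · exact W_pow_mono ht.2 3 (beta_mem ht.1 hk.1 hk.2)

theorem ee_one_mul_D_element {n : ℕ} (j : Index n) : ee 1 * D (element n j) = 0 := by
  rcases j with ⟨i, hi⟩ | ⟨⟨t, k⟩, ht, hk⟩
  · rw [element, mul_assoc, D_ee_one_mul, ee_one_mul_ee_one_mul]
  · rw [element, D_beta ht.1 hk.2, mul_zero]

/-- Multiplication by e^1 isolates the beta part, and contraction by e_1 then turns the rest into a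
relation modulo the image of `D`. -/
theorem element_independent {n : ℕ} (hn : 1 ≤ n) (s : Finset (Index n)) (g : Index n → ZMod 2)
    {z : Forms} (hz : z ∈ W n ^ 2) (h : ∑ j ∈ s, g j • element n j = ee 1 * D z) :
    ∀ j ∈ s, g j = 0 := by
  rw [← Finset.toLeft_disjSum_toRight (u := s), Finset.sum_disjSum] at h
  set u := ∑ i ∈ s.toLeft, g (Sum.inl i) • (ee ((i : ℕ) - 1) * ee (i : ℕ)) with hu
  set R := ∑ j ∈ s.toRight, g (Sum.inr j) • element n (Sum.inr j) with hR
  have hL : ∑ i ∈ s.toLeft, g (Sum.inl i) • element n (Sum.inl i) = ee 1 * u := by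
    rw [hu, Finset.mul_sum]
    refine Finset.sum_congr rfl fun i _ => ?_
    rw [element, mul_smul_comm, mul_assoc]
  rw [hL] at h
  have hR1 : contr 1 R = 0 := by
    rw [hR, map_sum]
    refine Finset.sum_eq_zero fun j _ => ?_
    rw [map_smul, element, contr_one_beta j.2.1.1 j.2.2.2, smul_zero]
  have hR0 : R = 0 := by
    refine eq_zero_of_contr_one hR1 ?_
    have := congrArg (fun x => ee 1 * x) h
    simpa only [mul_add, ee_one_mul_ee_one_mul, zero_add] using this
  rw [hR0, add_zero] at h
  have hu1 : contr 1 u = 0 := by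
    rw [hu, map_sum]
    refine Finset.sum_eq_zero fun i _ => ?_
    have := i.2
    rw [map_smul, contr_one_ee_mul_ee (by omega) (by omega), smul_zero]
  have huD : u = D (z + ee 1 * contr 1 z) := by
    have := congrArg (contr 1) h
    rw [contr_one_ee_one_mul, contr_one_ee_one_mul, hu1, mul_zero, add_zero, contr_one_D] at this
    rw [this, map_add, D_ee_one_mul]
  have hLz := two_form_independent s.toLeft (fun i : {i : ℕ // 2 + n / 2 ≤ i ∧ i ≤ n} => (i : ℕ))
    Subtype.val_injective (fun i => i.2) (fun i => g (Sum.inl i))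
    (add_mem hz (ee_mul_mem hn (contr_mem 1 z hz))) huD
  have hRz := beta_independent s.toRight (fun j => j.1.1) (fun j => j.1.2)
    (fun i j h1 h2 => Subtype.ext (Prod.ext h1 h2)) (fun j => j.2.1.1) (fun j => j.2.2.1)
    (fun j => j.2.2.2) (fun j => g (Sum.inr j)) hR0
  rintro (i | j) hj
  · exact hLz i (Finset.mem_toLeft.mpr hj)
  · exact hRz j (Finset.mem_toRight.mpr hj)

/-- The e^1-free part y + e^1 ∧ contr 1 y is closed, hence a combination of betas; the cofactor
`contr 1 y` is reduced modulo the image of `D`. -/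
theorem exists_add_mem_span_element {n : ℕ} (hn : 1 ≤ n) {y : Forms} (hy : y ∈ W n ^ 3)
    (hD : ee 1 * D y = 0) :
    ∃ z ∈ W n ^ 2, y + ee 1 * D z ∈ Submodule.span (ZMod 2) (Set.range (element n)) := by
  have hy0 : y + ee 1 * contr 1 y ∈ Submodule.span (ZMod 2) (Set.range (element n)) := by
    refine Submodule.span_mono ?_ (mem_span_beta n _
      (add_mem hy (ee_mul_mem hn (contr_mem 1 y hy))) ?_ ?_)
    · rintro _ ⟨t, k, ht, hk, rfl⟩
      exact ⟨Sum.inr ⟨(t, k), ht, hk⟩, rfl⟩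
    · rw [map_add, contr_one_ee_one_mul, contr_contr_self, mul_zero, add_zero, add_self_two]
    · have := contr_one_ee_one_mul (D y)
      rw [hD, map_zero, contr_one_D] at this
      rw [map_add, D_ee_one_mul, ← this]
  have hu := two_form_mem_sup (contr_mem 1 y hy) (contr_contr_self 1 y)
  obtain ⟨s, hs, _, ⟨z, hz, rfl⟩, hsz⟩ := Submodule.mem_sup.mp hu
  refine ⟨z, hz, ?_⟩
  have hs' : ee 1 * s ∈ Submodule.span (ZMod 2) (Set.range (element n)) := by
    clear hsz
    induction hs using Submodule.span_induction with
    | mem s hs =>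
      obtain ⟨i, hi, rfl⟩ := hs
      refine Submodule.subset_span ⟨Sum.inl ⟨i, hi⟩, ?_⟩
      rw [element, mul_assoc]
    | zero => rw [mul_zero]; exact zero_mem _
    | add a b _ _ ha hb => rw [mul_add]; exact add_mem ha hb
    | smul r a _ ha => rw [mul_smul_comm]; exact Submodule.smul_mem _ _ ha
  have h := add_mem hy0 hs'
  rw [← hsz, mul_add] at h
  have hre : y + (ee 1 * s + ee 1 * D z) + ee 1 * s = y + ee 1 * D z + (ee 1 * s + ee 1 * s) := by
    abel
  rwa [hre, add_self_two, add_zero] at h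

end

end MaxClass

theorem theorem3p7 (n : ℕ) (hn : 4 ≤ n) :
    (∀ t : ℕ, 4 ≤ t → t ≤ n → ∀ k : ℕ, 2 ≤ k → k ≤ MaxClass.mOf t →
      ∃ c ∈ ⋀[ZMod 2]^3 (Module.Dual (ZMod 2) (MaxClass.M0 t)),
        MaxClass.incl t c = MaxClass.beta t k) ∧
    ∃ B : Module.Basis (MaxClass.Index n) (ZMod 2)
        (MaxClass.cohomology (MaxClass.M0.basis n) 3),
      ∀ j : MaxClass.Index n, ∃ c : MaxClass.cocycles (MaxClass.M0.basis n) 3,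
        MaxClass.incl n (c : ExteriorAlgebra (ZMod 2) (Module.Dual (ZMod 2) (MaxClass.M0 n))) =
            MaxClass.element n j ∧
          B j = Submodule.Quotient.mk c := by
  open MaxClass in
  refine ⟨fun t ht _ k hk2 hk => exists_incl_eq (beta_mem ht hk2 hk), ?_⟩
  have hn1 : 1 ≤ n := by omega
  choose c hc using fun j : Index n =>
    exists_cocycle hn1 (element_mem hn1 j) (ee_one_mul_D_element j)
  let Q := (coboundaries (M0.basis n) 3).submoduleOf (cocycles (M0.basis n) 3)
  have hli : LinearIndependent (ZMod 2) fun j => Q.mkQ (c j) := by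
    refine linearIndependent_iff'.mpr fun s g hg => ?_
    simp only [← map_smul, ← map_sum] at hg
    rw [Submodule.mkQ_apply, Submodule.Quotient.mk_eq_zero] at hg
    obtain ⟨ω, hω, hg⟩ := Submodule.mem_comap.mp hg
    refine element_independent hn1 s g (incl_mem hω) ?_
    rw [← incl_ceD hn1, hg]
    simp [hc]
  have hsp : ⊤ ≤ Submodule.span (ZMod 2) (Set.range fun j => Q.mkQ (c j)) := by
    intro q _
    obtain ⟨x, rfl⟩ := Q.mkQ_surjective q
    have hx3 := incl_mem x.2.1
    have hxD : ee 1 * D (incl n x) = 0 := by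
      rw [← incl_ceD hn1, LinearMap.mem_ker.mp x.2.2, map_zero]
    obtain ⟨z, hz, hxz⟩ := exists_add_mem_span_element hn1 hx3 hxD
    obtain ⟨ζ, hζ, rfl⟩ := exists_incl_eq hz
    let f : cocycles (M0.basis n) 3 →ₗ[ZMod 2] Forms :=
      (incl n).toLinearMap ∘ₗ (cocycles (M0.basis n) 3).subtype
    -- The span in `Forms` is the image of the span of the chosen cocycles, so membership lifts back
    -- through the injective inclusion.
    have hrange : Set.range (element n) = f '' Set.range c := by
      rw [← Set.range_comp]
      congr 1
      exact funext fun j => (hc j).symm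
    rw [hrange, ← Submodule.map_span] at hxz
    obtain ⟨y, hy, hyx⟩ := hxz
    have hyx' : (y : ExteriorAlgebra (ZMod 2) (Module.Dual (ZMod 2) (M0 n))) =
        x + ceD (M0.basis n) ζ := by
      apply incl_injective n
      rw [map_add, incl_ceD hn1]
      exact hyx
    have hmk : Q.mkQ x = Q.mkQ y := by
      refine ((Submodule.Quotient.eq Q).mpr (Submodule.mem_comap.mpr ?_)).symm
      rw [map_sub, Submodule.subtype_apply, Submodule.subtype_apply, hyx', add_sub_cancel_left]
      exact ⟨ζ, hζ, rfl⟩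
    rw [hmk, show (Set.range fun j => Q.mkQ (c j)) = Q.mkQ '' Set.range c from
      Set.range_comp Q.mkQ c, ← Submodule.map_span]
    exact Submodule.mem_map_of_mem hy
  refine ⟨Module.Basis.mk hli hsp, fun j => ⟨c j, hc j, ?_⟩⟩
  rw [Module.Basis.mk_apply]
  rfl
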